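/- Let $T=(N,E)$ be a directed tree with root $r\in N$, where $N$ is at most countable: $E\subseteq N\times N$ and every node is reached from $r$ by exactly one directed walk (the trivial one for $r$ itself). Let $F=(F_n)_{n\in N}$ be univariate distribution functions and let $B=(B_e)_{e\in E}$, $C=(C_e)_{e\in E}$ be families of bivariate copulas. A random sequence $X=(X_n)_{n\in N}$ follows the Markov tree distribution $\mathcal M(F,T,B)$ if * $X_n$ has distribution function $F_n$ for every $n\in N$; * $P(X_i\le s,\,X_j\le t)=B_{(i,j)}(F_i(s),F_j(t))$ for all $(i,j)\in E$ and $s,t\in\mathbb R$; * for all finite disjoint $A,A'\subset N$ and every $i\in N$ that lies strictly inside the undirected path between $a$ and $a'$ for all $a\in A$, $a'\in A'$, the vectors $(X_n)_{n\in A}$ and $(X_n)_{n\in A'}$ are conditionally independent given $X_i$. A bivariate copula is SI if a random vector $(U,V)$ with this distribution function has $V$ stochastically increasing in $U$, i.e. the conditional law of $V$ given $U=u$ is increasing in $u$ in the usual stochastic order, outside a null set of the law of $U$; it is CI if moreover $U$ is stochastically increasing in $V$. We write $B_e\le_{lo}C_e$ if $B_e(u,v)\le C_e(u,v)$ for all $u,v\in[0,1]$.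 A function $f:\mathbb R^m\to\mathbb R$ is supermodular if $f(x)+f(y)\le f(x\wedge y)+f(x\vee y)$ for all $x,y$, with componentwise minimum and maximum. For random vectors, $V\le_{sm}W$ means that $\mathbb E f(V)\le\mathbb E f(W)$ for every weight $b(x)=1+\sum_{i=1}^m\varphi_i(x_i)$ with measurable $\varphi_i:\mathbb R\to[0,\infty)$, $\mathbb E\,b(V)<\infty$ and $\mathbb E\,b(W)<\infty$, and every measurable supermodular $f$ with $\sup_x|f(x)|/b(x)<\infty$. (All bounded $f$ are covered, and all $f$ of growth $O(1+\|x\|^p)$ if the components have finite $p$-th moments.) For random sequences, $V\le_{sm}W$ means $(V_{n_1},\dots,V_{n_m})\le_{sm}(W_{n_1},\dots,W_{n_m})$ for all $m$ and all $n_1,\dots,n_m\in N$. A random sequence $V$ is positive supermodular dependent (PSMD) if $V^\perp\le_{sm}V$, where $V^\perp$ has independent components with the same marginal laws as $V$. Let $X\sim\mathcal M(F,T,B)$ and $Y\sim\mathcal M(F,T,C)$. Assume that $B_e$ is SI and $C_e$ is CI for every $e\in E$. 1. If $B_e\le_{lo}C_e$ for all $e\in E$, then $X\le_{sm}Y$.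 2. If $B_e\ge_{lo}C_e$ for all $e\in E$, then $X\ge_{sm}Y$. Moreover, $X$ and $Y$ are PSMD. -/

import Mathlib

open MeasureTheory ProbabilityTheory Set
open scoped unitInterval

noncomputable section

/-! ### Directed trees -/

/-- `l` is the list of nodes visited by a directed walk from `i` to `j` along the edges `E`. -/
def IsDirectedWalk {N : Type*} (E : N → N → Prop) (i j : N) (l : List N) : Prop :=
  l.IsChain E ∧ l.head? = some i ∧ l.getLast? = some j

/-- `(N, E)` is a directed tree (arborescence) with root `r`: every node is reached from the root
by exactly one directed walk (for the root itself, the trivial one). Uniqueness among walks rules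
out loops, edges into the root and edges back to an ancestor; all walks from the root are then
paths. -/
def IsDirectedTree {N : Type*} (E : N → N → Prop) (r : N) : Prop :=
  ∀ i, ∃! l, IsDirectedWalk E r i l

/-- The node `i` separates `A` and `B`: on every undirected path between a node of `A` and a node
of `B`, `i` is a node other than the two endpoints. -/
def Separates {N : Type*} (E : N → N → Prop) (i : N) (A B : Finset N) : Prop :=
  ∀ a ∈ A, ∀ b ∈ B, ∀ p : (SimpleGraph.fromRel E).Walk a b, p.IsPath →
    i ∈ p.support ∧ i ≠ a ∧ i ≠ b

/-! ### Stochastic monotonicity -/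

/-- The stochastic order of distributions on the real line. -/
def StLE (μ ν : Measure ℝ) : Prop :=
  ∀ f : ℝ → ℝ, Monotone f → Integrable f μ → Integrable f ν → ∫ x, f x ∂μ ≤ ∫ x, f x ∂ν

/-- For `(U, V)` with law `γ`, the variable `V` is stochastically increasing in `U`: the
conditional law of `V` given `U = u` is increasing in `u` in the stochastic order, outside a null
set of the law of `U`. -/
def StochIncreasing (γ : Measure (ℝ × ℝ)) [IsFiniteMeasure γ] : Prop :=
  ∃ S : Set ℝ, γ.fst S = 0 ∧
    ∀ u ∉ S, ∀ u' ∉ S, u ≤ u' → StLE (γ.condKernel u) (γ.condKernel u')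

/-! ### Bivariate copulas -/

/-- The law `γ` of a bivariate random vector has distribution function `C` on the unit square. -/
def HasDF (γ : Measure (ℝ × ℝ)) (C : I → I → ℝ) : Prop :=
  ∀ u v : I, γ.real (Iic (u : ℝ) ×ˢ Iic (v : ℝ)) = C u v

/-- A bivariate copula: the restriction to the unit square of a bivariate distribution function
whose univariate marginals are uniform on `[0, 1]`. -/
structure Copula where
  toFun : I → I → ℝ
  exists_law : ∃ γ : Measure (ℝ × ℝ), IsProbabilityMeasure γ ∧
    γ.fst = volume.restrict (Icc 0 1) ∧ γ.snd = volume.restrict (Icc 0 1) ∧ HasDF γ toFun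

/-- The copula `C` is SI: some `(U, V)` with distribution function `C` has `V` stochastically
increasing in `U`. -/
def Copula.IsSI (C : Copula) : Prop :=
  ∃ (γ : Measure (ℝ × ℝ)) (_ : IsProbabilityMeasure γ), HasDF γ C.toFun ∧ StochIncreasing γ

/-- The copula `C` is CI: some `(U, V)` with distribution function `C` has `V` stochastically
increasing in `U` and `U` stochastically increasing in `V`. -/
def Copula.IsCI (C : Copula) : Prop :=
  ∃ (γ : Measure (ℝ × ℝ)) (_ : IsProbabilityMeasure γ), HasDF γ C.toFun ∧
    StochIncreasing γ ∧ StochIncreasing (γ.map Prod.swap)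

/-- The lower orthant order of copulas. -/
def Copula.LoLE (C D : Copula) : Prop :=
  ∀ u v : I, C.toFun u v ≤ D.toFun u v

/-! ### Markov tree distributions -/

/-- Markov tree dependence: whenever `i` separates the disjoint finite sets `A` and `B`, the
subvectors indexed by `A` and by `B` are conditionally independent given coordinate `i`. -/
def HasMarkovTreeDependence {N : Type*} [Countable N] (E : N → N → Prop)
    (μ : Measure (N → ℝ)) [IsFiniteMeasure μ] : Prop :=
  ∀ (A B : Finset N) (i : N), Disjoint A B → Separates E i A B →
    CondIndepFun (MeasurableSpace.comap (fun x : N → ℝ => x i) inferInstance)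
      (measurable_pi_apply i).comap_le
      (fun (x : N → ℝ) (a : A) => x a) (fun (x : N → ℝ) (b : B) => x b) μ

/-- `μ` realizes the bivariate tree specification `(F, (N, E), B)`: `F n` is the distribution
function of coordinate `n`, and `B i j` is a copula of coordinates `(i, j)` for each edge. -/
def Realizes {N : Type*} (F : N → ℝ → I) (E : N → N → Prop) (B : ∀ i j, E i j → Copula)
    (μ : Measure (N → ℝ)) : Prop :=
  (∀ n t, μ.real {x | x n ≤ t} = F n t) ∧
  ∀ i j (h : E i j) s t, μ.real {x | x i ≤ s ∧ x j ≤ t} = (B i j h).toFun (F i s) (F j t)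

/-- The random sequence `X` follows the Markov tree distribution `M(F, (N, E), B)`. -/
def FollowsMarkovTree {N Ω : Type*} [Countable N] [MeasurableSpace Ω]
    (F : N → ℝ → I) (E : N → N → Prop) (B : ∀ i j, E i j → Copula)
    (X : Ω → N → ℝ) (P : Measure Ω) : Prop :=
  ∃ (μ : Measure (N → ℝ)) (_ : IsProbabilityMeasure μ),
    HasLaw X μ P ∧ Realizes F E B μ ∧ HasMarkovTreeDependence E μ

/-! ### The supermodular order -/

/-- Supermodularity with respect to componentwise minimum and maximum. -/
def Supermodular {ι : Type*} (f : (ι → ℝ) → ℝ) : Prop :=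
  ∀ x y, f x + f y ≤ f (x ⊓ y) + f (x ⊔ y)

/-- The weight function `b(x) = 1 + ∑ i, φ i (x i)`. For `φ i t = |t| ^ p` it is equivalent, up to
constant factors, to `max 1 (‖x‖ ^ p)`. -/
def weight {ι : Type*} [Fintype ι] (φ : ι → ℝ → ℝ) (x : ι → ℝ) : ℝ :=
  1 + ∑ i, φ i (x i)

/-- The supermodular order of laws of random vectors: for every weight `b` for which both laws are
`b`-integrable, the integrals of all measurable `b`-bounded supermodular functions are ordered.
Such functions are integrable with respect to both laws. -/
def SupermodularLE {ι : Type*} [Fintype ι] (μ ν : Measure (ι → ℝ)) : Prop :=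
  ∀ φ : ι → ℝ → ℝ, (∀ i, Measurable (φ i)) → (∀ i t, 0 ≤ φ i t) →
    Integrable (weight φ) μ → Integrable (weight φ) ν →
    ∀ f : (ι → ℝ) → ℝ, Measurable f → Supermodular f → (∃ c, ∀ x, |f x| ≤ c * weight φ x) →
      ∫ x, f x ∂μ ≤ ∫ x, f x ∂ν

/-- The supermodular order of laws of random sequences: all vectors of finitely many coordinates
are ordered. For finite `N` an enumeration of `N` gives the comparison of the whole vectors. -/
def ProcessSupermodularLE {N : Type*} (μ ν : Measure (N → ℝ)) : Prop :=
  ∀ (m : ℕ) (k : Fin m → N),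
    SupermodularLE (μ.map fun x i => x (k i)) (ν.map fun x i => x (k i))

/-- Positive supermodular dependence: the law of independent coordinates with the same marginals
is smaller in the supermodular order. -/
def PSMD {N : Type*} (μ : Measure (N → ℝ)) : Prop :=
  ProcessSupermodularLE (Measure.infinitePi fun n => μ.map fun x => x n) μ

end

/-!
It suffices to test with bounded functions, since increasing truncations of the coordinates preserve
supermodularity, and to compare the coordinates in a finite subtree that contains the root, which
grows from the root by attaching leaves. Suppose that a leaf `j` is attached to `p`, and let `g` be
supermodular.

* Under the SI law, averaging `g` over `X j` given `X p` leaves a supermodular function of the old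
  coordinates: this uses only that the conditional law of `X j` increases. The induction hypothesis
  compares its integrals under `X` and `Y`.
* Under the CI law the old coordinates increase jointly with `Y p`, whatever the position of `p`,
  because the edges increase in both directions. So averaging `g` over them, given `Y p = s` and
  with `t` in place of the coordinate `j`, gives a function of `(s, t)` with increasing differences.
  The lower orthant order of the laws of the edge `(p, j)` controls its integral.

Both changes have the same sign, so the copulas may be ordered in either direction. A product law
increases in both directions and lies below every SI law, which yields the PSMD property.

Conditional laws increase only off null sets; they are replaced by globally increasing kernels that
agree with them outside sets of small mass.
-/

/-! ### Monotone functions and laws on the line -/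

theorem integrable_of_forall_abs_le {α : Type*} [MeasurableSpace α] {μ : Measure α}
    [IsFiniteMeasure μ] {f : α → ℝ} (hf : Measurable f) {c : ℝ} (hc : ∀ x, |f x| ≤ c) :
    Integrable f μ :=
  .of_bound hf.aestronglyMeasurable c (.of_forall hc)

theorem abs_integral_le_of_forall_abs_le {α : Type*} [MeasurableSpace α] {μ : Measure α}
    [IsProbabilityMeasure μ] {f : α → ℝ} {c : ℝ} (hc : ∀ x, |f x| ≤ c) : |∫ x, f x ∂μ| ≤ c := by
  simpa using norm_integral_le_of_norm_le_const (μ := μ) (f := f) (.of_forall hc)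

theorem measure_le_of_isLowerSet {α : Type*} [LinearOrder α] [TopologicalSpace α] [OrderTopology α]
    [SecondCountableTopology α] [MeasurableSpace α] [BorelSpace α] {μ ν : Measure α}
    (h : ∀ t, μ (Iic t) ≤ ν (Iic t)) {L : Set α} (hL : IsLowerSet L) : μ L ≤ ν L := by
  have hLm : MeasurableSet L := hL.ordConnected.measurableSet
  have : L.OrdConnected := hL.ordConnected
  have comap_eq (μ : Measure α) (V : Set L) : μ.comap (Subtype.val : L → α) V = μ ((↑) '' V) :=
    (MeasurableEmbedding.subtype_coe hLm).comap_apply μ V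
  have image_Iic (t : L) : ((↑) '' Iic t : Set α) = Iic (t : α) := by
    ext x
    exact ⟨fun ⟨_, hy, hyx⟩ => hyx ▸ hy, fun hx => ⟨⟨x, hL hx t.2⟩, hx, rfl⟩⟩
  rcases isEmpty_or_nonempty L with hempty | hne
  · simp [isEmpty_coe_sort.1 hempty]
  simpa only [comap_eq, image_univ, Subtype.range_coe] using
    le_of_tendsto_of_tendsto' (tendsto_measure_Iic_atTop (μ.comap ((↑) : L → α)))
      (tendsto_measure_Iic_atTop (ν.comap ((↑) : L → α))) fun t => by
        simpa only [comap_eq, image_Iic] using h t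

theorem integral_le_of_measure_Iic_le {μ ν : Measure ℝ} [IsFiniteMeasure μ] [IsFiniteMeasure ν]
    (huniv : μ univ = ν univ) (h : ∀ t, ν (Iic t) ≤ μ (Iic t)) {g : ℝ → ℝ} (hg : Monotone g)
    {c : ℝ} (hc : ∀ x, |g x| ≤ c) : ∫ x, g x ∂μ ≤ ∫ x, g x ∂ν := by
  have hint (μ : Measure ℝ) [IsFiniteMeasure μ] : Integrable g μ :=
    integrable_of_forall_abs_le hg.measurable hc
  have hnonneg : 0 ≤ fun x => c - g x := fun x => by
    simpa using (le_abs_self _).trans (hc x)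
  have hmeas : Measurable fun x => c - g x := hg.measurable.const_sub c
  have layer : ∫⁻ x, ENNReal.ofReal (c - g x) ∂ν ≤ ∫⁻ x, ENNReal.ofReal (c - g x) ∂μ := by
    rw [lintegral_eq_lintegral_meas_lt ν (.of_forall hnonneg) hmeas.aemeasurable,
      lintegral_eq_lintegral_meas_lt μ (.of_forall hnonneg) hmeas.aemeasurable]
    exact lintegral_mono fun t => measure_le_of_isLowerSet h fun x y hyx (hx : t < c - g x) =>
      hx.trans_le (sub_le_sub_left (hg hyx) c)
  have key : ∫ x, (c - g x) ∂ν ≤ ∫ x, (c - g x) ∂μ := by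
    rw [integral_eq_lintegral_of_nonneg_ae (.of_forall hnonneg) hmeas.aestronglyMeasurable,
      integral_eq_lintegral_of_nonneg_ae (.of_forall hnonneg) hmeas.aestronglyMeasurable]
    exact ENNReal.toReal_mono ((integrable_const c).sub (hint μ)).lintegral_lt_top.ne layer
  rw [integral_sub (integrable_const c) (hint ν), integral_sub (integrable_const c) (hint μ),
    integral_const, integral_const, measureReal_def, measureReal_def, huniv] at key
  linarith

theorem exists_monotone_retraction {K : Set ℝ} (hK : IsClosed K) (hne : K.Nonempty) :
    ∃ π : ℝ → ℝ, Monotone π ∧ (∀ t, π t ∈ K) ∧ ∀ t ∈ K, π t = t := by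
  classical
  have bdd (t : ℝ) : BddAbove (K ∩ Iic t) := bddAbove_Iic.mono inter_subset_right
  have sSup_mem {t : ℝ} (h : (K ∩ Iic t).Nonempty) : sSup (K ∩ Iic t) ∈ K :=
    ((hK.inter isClosed_Iic).csSup_mem h (bdd t)).1
  have bddBelow {t : ℝ} (h : ¬(K ∩ Iic t).Nonempty) : BddBelow K :=
    ⟨t, fun x hx => le_of_not_ge fun hxt => h ⟨x, hx, hxt⟩⟩
  refine ⟨fun t => if (K ∩ Iic t).Nonempty then sSup (K ∩ Iic t) else sInf K, ?_, ?_, ?_⟩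
  · intro s t hst
    have hsub : K ∩ Iic s ⊆ K ∩ Iic t := inter_subset_inter_right _ (Iic_subset_Iic.2 hst)
    by_cases hs : (K ∩ Iic s).Nonempty
    · simpa only [if_pos hs, if_pos (hs.mono hsub)] using csSup_le_csSup (bdd t) hs hsub
    by_cases ht : (K ∩ Iic t).Nonempty
    · simpa only [if_neg hs, if_pos ht] using csInf_le (bddBelow hs) (sSup_mem ht)
    · simp only [if_neg hs, if_neg ht, le_refl]
  · intro t
    by_cases h : (K ∩ Iic t).Nonempty
    · simpa only [if_pos h] using sSup_mem h
    · simpa only [if_neg h] using hK.csInf_mem hne (bddBelow h)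
  · intro t ht
    have hgreatest : IsGreatest (K ∩ Iic t) t := ⟨⟨ht, self_mem_Iic⟩, fun x hx => hx.2⟩
    simpa only [if_pos hgreatest.nonempty] using hgreatest.csSup_eq

/-! ### The lower orthant order on the plane -/

/-- Increasing differences: supermodularity for functions of two real variables. -/
def IncreasingDifferences (h : ℝ × ℝ → ℝ) : Prop :=
  ∀ s s' t t', s ≤ s' → t ≤ t' → h (s, t') + h (s', t) ≤ h (s, t) + h (s', t')

/-- The lower orthant order of laws on the plane with equal marginals. -/
structure OrthantLE (γ δ : Measure (ℝ × ℝ)) : Prop where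
  fst_eq : γ.fst = δ.fst
  snd_eq : γ.snd = δ.snd
  le : ∀ s t, γ (Iic s ×ˢ Iic t) ≤ δ (Iic s ×ˢ Iic t)

theorem fst_restrict_preimage_snd_apply {α β : Type*} [MeasurableSpace α] [MeasurableSpace β]
    (γ : Measure (α × β)) {V : Set α} (hV : MeasurableSet V) (W : Set β) :
    (γ.restrict (Prod.snd ⁻¹' W)).fst V = γ (V ×ˢ W) := by
  rw [Measure.fst_apply hV, Measure.restrict_apply (measurable_fst hV), prod_eq]

theorem snd_restrict_preimage_fst_apply {α β : Type*} [MeasurableSpace α] [MeasurableSpace β]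
    (γ : Measure (α × β)) (V : Set α) {W : Set β} (hW : MeasurableSet W) :
    (γ.restrict (Prod.fst ⁻¹' V)).snd W = γ (V ×ˢ W) := by
  rw [Measure.snd_apply hW, Measure.restrict_apply (measurable_snd hW), inter_comm, prod_eq]

theorem integral_comp_fst {α β : Type*} [MeasurableSpace α] [MeasurableSpace β]
    (γ : Measure (α × β)) {g : α → ℝ} (hg : Measurable g) :
    ∫ z, g z.1 ∂γ = ∫ s, g s ∂γ.fst :=
  (integral_map measurable_fst.aemeasurable hg.aestronglyMeasurable).symm

theorem integral_comp_snd {α β : Type*} [MeasurableSpace α] [MeasurableSpace β]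
    (γ : Measure (α × β)) {g : β → ℝ} (hg : Measurable g) :
    ∫ z, g z.2 ∂γ = ∫ t, g t ∂γ.snd :=
  (integral_map measurable_snd.aemeasurable hg.aestronglyMeasurable).symm

theorem exists_monotone_finite_range_approx {w : ℝ → ℝ} (hw : Monotone w) {c : ℝ}
    (hc : ∀ t, |w t| ≤ c) {ε : ℝ} (hε : 0 < ε) :
    ∃ ψ : ℝ → ℝ, Monotone ψ ∧ (range ψ).Finite ∧ ∀ t, |w (ψ t) - w t| ≤ ε := by
  let level (t : ℝ) : ℤ := ⌊w t / ε⌋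
  have level_mono : Monotone level := fun s t hst =>
    Int.floor_le_floor (div_le_div_of_nonneg_right (hw hst) hε.le)
  obtain ⟨rep, hrep⟩ : ∃ rep : ℤ → ℝ, ∀ t, level (rep (level t)) = level t :=
    ⟨Function.invFun level, fun t => Function.invFun_eq ⟨t, rfl⟩⟩
  refine ⟨fun t => rep (level t), fun s t hst => ?_, ?_, fun t => ?_⟩
  · rcases (level_mono hst).eq_or_lt with h | h
    · exact (congrArg rep h).le
    · by_contra! hlt
      exact h.not_ge (by simpa only [hrep] using level_mono hlt.le)
  · refine ((finite_Icc ⌊-c / ε⌋ ⌊c / ε⌋).image rep).subset (range_subset_iff.2 fun t => ?_)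
    obtain ⟨hlo, hhi⟩ := abs_le.1 (hc t)
    exact ⟨level t, ⟨Int.floor_le_floor (div_le_div_of_nonneg_right hlo hε.le),
      Int.floor_le_floor (div_le_div_of_nonneg_right hhi hε.le)⟩, rfl⟩
  · have h := Int.abs_sub_lt_one_of_floor_eq_floor (hrep t)
    rw [← sub_div, abs_div, abs_of_pos hε, div_lt_one hε] at h
    exact h.le

namespace OrthantLE

variable {γ δ : Measure (ℝ × ℝ)}

theorem integral_comp_fst_eq (H : OrthantLE γ δ) {g : ℝ → ℝ} (hg : Measurable g) :
    ∫ z, g z.1 ∂γ = ∫ z, g z.1 ∂δ := by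
  rw [integral_comp_fst γ hg, integral_comp_fst δ hg, H.fst_eq]

theorem integral_comp_snd_eq (H : OrthantLE γ δ) {g : ℝ → ℝ} (hg : Measurable g) :
    ∫ z, g z.2 ∂γ = ∫ z, g z.2 ∂δ := by
  rw [integral_comp_snd γ hg, integral_comp_snd δ hg, H.snd_eq]

theorem measure_Iic_prod_le (H : OrthantLE γ δ) (s : ℝ) {L : Set ℝ} (hL : IsLowerSet L) :
    γ (Iic s ×ˢ L) ≤ δ (Iic s ×ˢ L) := by
  have hLm : MeasurableSet L := hL.ordConnected.measurableSet
  rw [← snd_restrict_preimage_fst_apply γ _ hLm, ← snd_restrict_preimage_fst_apply δ _ hLm]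
  refine measure_le_of_isLowerSet (fun t => ?_) hL
  simpa only [snd_restrict_preimage_fst_apply _ _ measurableSet_Iic] using H.le s t

variable [IsProbabilityMeasure γ] [IsProbabilityMeasure δ]

theorem setIntegral_comp_fst_le (H : OrthantLE γ δ) {L : Set ℝ} (hL : IsLowerSet L)
    {g : ℝ → ℝ} (hg : Antitone g) {c : ℝ} (hc : ∀ x, |g x| ≤ c) :
    ∫ z in Prod.snd ⁻¹' L, g z.1 ∂γ ≤ ∫ z in Prod.snd ⁻¹' L, g z.1 ∂δ := by
  have hLm : MeasurableSet L := hL.ordConnected.measurableSet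
  have huniv : (δ.restrict (Prod.snd ⁻¹' L)).fst univ = (γ.restrict (Prod.snd ⁻¹' L)).fst univ := by
    simp only [Measure.fst_univ, Measure.restrict_apply_univ, ← Measure.snd_apply hLm, H.snd_eq]
  have h := integral_le_of_measure_Iic_le huniv (fun t => by
    simpa only [fst_restrict_preimage_snd_apply _ measurableSet_Iic] using
      H.measure_Iic_prod_le t hL) hg.neg (c := c) (fun x => by simpa using hc x)
  simpa only [Pi.neg_apply, integral_neg, neg_le_neg_iff,
    ← integral_comp_fst _ hg.measurable] using h

/-- Raising the lowest value `a` of `ψ` to `b` changes the integrand by an antitone function of the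
first coordinate, on a lower set of the second. -/
theorem integral_le_of_integral_max_le (H : OrthantLE γ δ) {h : ℝ × ℝ → ℝ}
    (hh : Measurable h) {c : ℝ} (hc : ∀ z, |h z| ≤ c) (hinc : IncreasingDifferences h)
    {a b : ℝ} (hab : a < b) {ψ : ℝ → ℝ} (hψ : Monotone ψ) (hψab : ∀ t, ψ t = a ∨ b ≤ ψ t)
    (hmax : ∫ z, h (z.1, max (ψ z.2) b) ∂γ ≤ ∫ z, h (z.1, max (ψ z.2) b) ∂δ) :
    ∫ z, h (z.1, ψ z.2) ∂γ ≤ ∫ z, h (z.1, ψ z.2) ∂δ := by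
  let L := {t | ψ t < b}
  have hL : IsLowerSet L := fun s t hts hs => (hψ hts).trans_lt hs
  have hLm : MeasurableSet (Prod.snd ⁻¹' L : Set (ℝ × ℝ)) :=
    measurable_snd hL.ordConnected.measurableSet
  have hsplit (z : ℝ × ℝ) : h (z.1, ψ z.2) = h (z.1, max (ψ z.2) b) +
      (Prod.snd ⁻¹' L).indicator (fun z => h (z.1, a) - h (z.1, b)) z := by
    rcases hψab z.2 with hza | hz
    · have hmem : z ∈ Prod.snd ⁻¹' L := show ψ z.2 < b from hza ▸ hab
      rw [indicator_of_mem hmem, hza, max_eq_right hab.le, add_sub_cancel]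
    · have hmem : z ∉ Prod.snd ⁻¹' L := hz.not_gt
      rw [indicator_of_notMem hmem, max_eq_left hz, add_zero]
  have hdc (z : ℝ × ℝ) : |h (z.1, a) - h (z.1, b)| ≤ c + c :=
    (abs_sub _ _).trans (add_le_add (hc _) (hc _))
  have hψm : Measurable ψ := hψ.measurable
  have hint (γ : Measure (ℝ × ℝ)) [IsProbabilityMeasure γ] :
      Integrable (fun z => h (z.1, max (ψ z.2) b)) γ ∧
        Integrable ((Prod.snd ⁻¹' L).indicator fun z => h (z.1, a) - h (z.1, b)) γ :=
    ⟨integrable_of_forall_abs_le (by fun_prop) fun z => hc _,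
      (integrable_of_forall_abs_le (by fun_prop) hdc).indicator hLm⟩
  simp only [hsplit]
  rw [integral_add (hint γ).1 (hint γ).2, integral_add (hint δ).1 (hint δ).2,
    integral_indicator hLm, integral_indicator hLm]
  refine add_le_add hmax (H.setIntegral_comp_fst_le hL
    (g := fun s => h (s, a) - h (s, b)) (fun s s' hs => ?_) fun s => hdc (s, 0))
  have := hinc s s' a b hs hab.le
  dsimp only
  linarith

theorem integral_finite_range_le (H : OrthantLE γ δ) {h : ℝ × ℝ → ℝ}
    (hh : Measurable h) {c : ℝ} (hc : ∀ z, |h z| ≤ c) (hinc : IncreasingDifferences h)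
    (G : Finset ℝ) {ψ : ℝ → ℝ} (hψ : Monotone ψ) (hG : ∀ t, ψ t ∈ G) :
    ∫ z, h (z.1, ψ z.2) ∂γ ≤ ∫ z, h (z.1, ψ z.2) ∂δ := by
  induction G using Finset.induction_on_min generalizing ψ with
  | empty => exact absurd (hG 0) (Finset.notMem_empty _)
  | insert a G ha ih =>
    rcases G.eq_empty_or_nonempty with rfl | hne
    · have hψa (t : ℝ) : ψ t = a := by simpa using hG t
      simp only [hψa]
      exact (H.integral_comp_fst_eq (g := fun s => h (s, a)) (by fun_prop)).le
    have hψb (t : ℝ) : ψ t = a ∨ G.min' hne ≤ ψ t :=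
      (Finset.mem_insert.1 (hG t)).imp_right (G.min'_le _)
    refine H.integral_le_of_integral_max_le hh hc hinc (ha _ (G.min'_mem hne)) hψ hψb
      (ih (fun s t hst => max_le_max_right _ (hψ hst)) fun t => ?_)
    rcases Finset.mem_insert.1 (hG t) with hta | ht
    · simpa only [hta, max_eq_right (ha _ (G.min'_mem hne)).le] using G.min'_mem hne
    · rwa [max_eq_left (G.min'_le _ ht)]

theorem integral_le_of_abs_sub_le (H : OrthantLE γ δ) {k : ℝ × ℝ → ℝ}
    (hk : Measurable k) {c : ℝ} (hc : ∀ z, |k z| ≤ c) (hinc : IncreasingDifferences k)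
    {w : ℝ → ℝ} (hw : Monotone w) {c' : ℝ} (hwc : ∀ t, |w t| ≤ c')
    (hkw : ∀ s t t', |k (s, t') - k (s, t)| ≤ |w t' - w t|) :
    ∫ z, k z ∂γ ≤ ∫ z, k z ∂δ := by
  refine le_of_forall_pos_le_add fun ε hε => ?_
  obtain ⟨ψ, hψ, hfin, happ⟩ := exists_monotone_finite_range_approx hw hwc (half_pos hε)
  have hstep := H.integral_finite_range_le hk hc hinc hfin.toFinset hψ fun t => by simp
  have hψm : Measurable ψ := hψ.measurable
  have hclose (γ : Measure (ℝ × ℝ)) [IsProbabilityMeasure γ] :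
      |∫ z, k (z.1, ψ z.2) ∂γ - ∫ z, k z ∂γ| ≤ ε / 2 := by
    rw [← integral_sub (integrable_of_forall_abs_le (by fun_prop) fun z => hc _)
      (integrable_of_forall_abs_le hk hc)]
    exact abs_integral_le_of_forall_abs_le fun z => (hkw z.1 z.2 (ψ z.2)).trans (happ z.2)
  linarith [(abs_le.1 (hclose γ)).1, (abs_le.1 (hclose δ)).2]

/-- Once the first coordinate stays in `[-R, R]`, the increments of the integrand in the second
coordinate are dominated by those of the monotone function `t ↦ h (R, t) - h (-R, t)`. -/
theorem integral_clamp_le (H : OrthantLE γ δ) {h : ℝ × ℝ → ℝ}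
    (hh : Measurable h) {c : ℝ} (hc : ∀ z, |h z| ≤ c) (hinc : IncreasingDifferences h)
    {R : ℝ} (hR : 0 ≤ R) :
    ∫ z, h (max (-R) (min z.1 R), z.2) ∂γ ≤ ∫ z, h (max (-R) (min z.1 R), z.2) ∂δ := by
  let p (s : ℝ) : ℝ := max (-R) (min s R)
  have hp : Monotone p := fun s t hst => max_le_max_left _ (min_le_min_right _ hst)
  have hlo (s : ℝ) : -R ≤ p s := le_max_left _ _
  have hhi (s : ℝ) : p s ≤ R := max_le (by linarith) (min_le_right _ _)
  have hpm : Measurable p := hp.measurable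
  let k (z : ℝ × ℝ) : ℝ := h (p z.1, z.2) - h (-R, z.2)
  have hkm : Measurable k := by fun_prop
  have hdc (z z' : ℝ × ℝ) : |h z - h z'| ≤ c + c :=
    (abs_sub _ _).trans (add_le_add (hc _) (hc _))
  have hkinc : IncreasingDifferences k := fun s s' t t' hs ht => by
    linarith [hinc (p s) (p s') t t' (hp hs) ht]
  have hctrl {t t' : ℝ} (s : ℝ) (ht : t ≤ t') : |k (s, t') - k (s, t)| ≤
      |(h (R, t') - h (-R, t')) - (h (R, t) - h (-R, t))| := by
    have h₁ := hinc (-R) (p s) t t' (hlo s) ht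
    have h₂ := hinc (p s) R t t' (hhi s) ht
    have hpos : 0 ≤ k (s, t') - k (s, t) := by simp only [k]; linarith
    rw [abs_of_nonneg hpos]
    refine le_trans ?_ (le_abs_self _)
    simp only [k]
    linarith
  have hk : ∫ z, k z ∂γ ≤ ∫ z, k z ∂δ := by
    refine H.integral_le_of_abs_sub_le hkm (fun z => hdc _ _) hkinc
      (w := fun t => h (R, t) - h (-R, t)) (fun t t' ht => ?_) (fun t => hdc _ _) fun s t t' => ?_
    · linarith [hinc (-R) R t t' (by linarith) ht]
    · rcases le_total t t' with ht | ht
      · exact hctrl s ht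
      · simpa only [abs_sub_comm] using hctrl s ht
  have hint (γ : Measure (ℝ × ℝ)) [IsProbabilityMeasure γ] :
      Integrable (fun z => h (p z.1, z.2)) γ ∧ Integrable (fun z => h (-R, z.2)) γ :=
    ⟨integrable_of_forall_abs_le (by fun_prop) fun z => hc _,
      integrable_of_forall_abs_le (by fun_prop) fun z => hc _⟩
  rw [integral_sub (hint γ).1 (hint γ).2, integral_sub (hint δ).1 (hint δ).2,
    H.integral_comp_snd_eq (g := fun t => h (-R, t)) (by fun_prop)] at hk
  linarith

theorem integral_le (H : OrthantLE γ δ) {h : ℝ × ℝ → ℝ}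
    (hh : Measurable h) {c : ℝ} (hc : ∀ z, |h z| ≤ c) (hinc : IncreasingDifferences h) :
    ∫ z, h z ∂γ ≤ ∫ z, h z ∂δ := by
  have hlim (γ : Measure (ℝ × ℝ)) [IsProbabilityMeasure γ] :
      Filter.Tendsto (fun n : ℕ => ∫ z, h (max (-(n : ℝ)) (min z.1 n), z.2) ∂γ) Filter.atTop
        (nhds (∫ z, h z ∂γ)) := by
    refine tendsto_integral_of_dominated_convergence (fun _ => c)
      (fun n => (Measurable.aestronglyMeasurable (by fun_prop))) (integrable_const c)
      (fun n => .of_forall fun z => hc _) (.of_forall fun z => tendsto_const_nhds.congr' ?_)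
    filter_upwards [Filter.eventually_ge_atTop ⌈|z.1|⌉₊] with n hn
    obtain ⟨hlo, hhi⟩ := abs_le.1 (Nat.ceil_le.1 hn)
    rw [min_eq_left hhi, max_eq_right hlo]
  exact le_of_tendsto_of_tendsto' (hlim γ) (hlim δ) fun n =>
    H.integral_clamp_le hh hc hinc n.cast_nonneg

end OrthantLE

/-! ### Stochastic monotonicity on intervals -/

/-- For `(U, V)` with law `γ`, the conditional law of `V` given that `U` lies in an interval
increases stochastically when the interval moves to the right. Multiplying out the conditional
probabilities admits intervals of probability zero. -/
def IntervalwiseIncreasing (γ : Measure (ℝ × ℝ)) : Prop :=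
  ∀ ⦃a b c d : ℝ⦄, a ≤ b → b ≤ c → c ≤ d → ∀ t,
    γ (Ioc c d ×ˢ Iic t) * γ.fst (Ioc a b) ≤ γ (Ioc a b ×ˢ Iic t) * γ.fst (Ioc c d)

theorem StLE.measure_Iic_le {μ ν : Measure ℝ} [IsFiniteMeasure μ] [IsFiniteMeasure ν]
    (h : StLE μ ν) (t : ℝ) : ν (Iic t) ≤ μ (Iic t) := by
  have hanti : Antitone ((Iic t).indicator (1 : ℝ → ℝ)) := fun x y hxy => by
    by_cases hy : y ∈ Iic t
    · rw [indicator_of_mem hy, indicator_of_mem (mem_Iic.2 (hxy.trans hy))]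
      rfl
    · rw [indicator_of_notMem hy]
      exact indicator_nonneg (fun _ _ => zero_le_one) x
  have hint (μ : Measure ℝ) [IsFiniteMeasure μ] : Integrable (-(Iic t).indicator (1 : ℝ → ℝ)) μ :=
    ((integrable_const 1).indicator measurableSet_Iic).neg
  have hle := h _ hanti.neg (hint μ) (hint ν)
  simp only [integral_neg, neg_le_neg_iff,
    integral_indicator_one measurableSet_Iic] at hle
  exact (ENNReal.toReal_le_toReal (by finiteness) (by finiteness)).1 hle

theorem StochIncreasing.intervalwiseIncreasing {γ : Measure (ℝ × ℝ)} [IsFiniteMeasure γ]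
    (h : StochIncreasing γ) : IntervalwiseIncreasing γ := by
  obtain ⟨S, hS, hmono⟩ := h
  have hae : ∀ᵐ u ∂γ.fst, u ∉ S := measure_eq_zero_iff_ae_notMem.1 hS
  intro a b c d _ hbc _ t
  rw [← Measure.setLIntegral_condKernel_eq_measure_prod measurableSet_Ioc measurableSet_Iic,
    ← Measure.setLIntegral_condKernel_eq_measure_prod measurableSet_Ioc measurableSet_Iic]
  set m := ⨆ u ∈ Ioc c d \ S, γ.condKernel u (Iic t)
  have hright : ∫⁻ u in Ioc c d, γ.condKernel u (Iic t) ∂γ.fst ≤ m * γ.fst (Ioc c d) := by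
    rw [← setLIntegral_const]
    refine setLIntegral_mono_ae' measurableSet_Ioc ?_
    filter_upwards [hae] with u hu hu'
    exact le_iSup₂ (f := fun u _ => γ.condKernel u (Iic t)) u ⟨hu', hu⟩
  have hleft : m * γ.fst (Ioc a b) ≤ ∫⁻ u in Ioc a b, γ.condKernel u (Iic t) ∂γ.fst := by
    rw [← setLIntegral_const]
    refine setLIntegral_mono_ae' measurableSet_Ioc ?_
    filter_upwards [hae] with u hu hu'
    exact iSup₂_le fun u' hu'' =>
      (hmono u hu u' hu''.2 ((hu'.2.trans hbc).trans hu''.1.1.le)).measure_Iic_le t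
  calc _ ≤ m * γ.fst (Ioc c d) * γ.fst (Ioc a b) := by gcongr
    _ = m * γ.fst (Ioc a b) * γ.fst (Ioc c d) := by ring
    _ ≤ _ := by gcongr

theorem IntervalwiseIncreasing.prod (μ ν : Measure ℝ) [IsProbabilityMeasure μ]
    [IsProbabilityMeasure ν] : IntervalwiseIncreasing (μ.prod ν) := by
  intro a b c d _ _ _ t
  rw [Measure.fst_prod, Measure.prod_prod, Measure.prod_prod]
  exact le_of_eq (by ring)

theorem measureReal_Ioc_eq_sub (μ : Measure ℝ) [IsFiniteMeasure μ] {a b : ℝ} (hab : a ≤ b) :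
    μ.real (Ioc a b) = μ.real (Iic b) - μ.real (Iic a) := by
  rw [← Iic_sdiff_Iic, measureReal_sdiff (Iic_subset_Iic.2 hab) measurableSet_Iic]

theorem measureReal_Ioc_prod_eq_sub (γ : Measure (ℝ × ℝ)) [IsFiniteMeasure γ] {a b : ℝ}
    (hab : a ≤ b) (W : Set ℝ) :
    γ.real (Ioc a b ×ˢ W) = γ.real (Iic b ×ˢ W) - γ.real (Iic a ×ˢ W) := by
  simpa only [measureReal_def, fst_restrict_preimage_snd_apply γ measurableSet_Iic,
    fst_restrict_preimage_snd_apply γ measurableSet_Ioc] using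
    measureReal_Ioc_eq_sub (γ.restrict (Prod.snd ⁻¹' W)).fst hab

theorem intervalwiseIncreasing_iff {γ : Measure (ℝ × ℝ)} [IsFiniteMeasure γ] :
    IntervalwiseIncreasing γ ↔ ∀ ⦃a b c d : ℝ⦄, a ≤ b → b ≤ c → c ≤ d → ∀ t,
      (γ.real (Iic d ×ˢ Iic t) - γ.real (Iic c ×ˢ Iic t)) *
          (γ.fst.real (Iic b) - γ.fst.real (Iic a)) ≤
        (γ.real (Iic b ×ˢ Iic t) - γ.real (Iic a ×ˢ Iic t)) *
          (γ.fst.real (Iic d) - γ.fst.real (Iic c)) := by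
  refine forall₄_congr fun a b c d => forall₄_congr fun hab _ hcd t => ?_
  rw [← measureReal_Ioc_prod_eq_sub γ hab, ← measureReal_Ioc_prod_eq_sub γ hcd,
    ← measureReal_Ioc_eq_sub γ.fst hab, ← measureReal_Ioc_eq_sub γ.fst hcd]
  simp only [measureReal_def, ← ENNReal.toReal_mul]
  exact (ENNReal.toReal_le_toReal (by finiteness) (by finiteness)).symm

/-! ### Copulas -/

/-- Concavity of `c` in its first argument, as monotonicity of the slopes of chords over
consecutive intervals, multiplied out. -/
def ConcaveFst (c : I → I → ℝ) : Prop :=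
  ∀ ⦃u₁ u₂ u₃ u₄ : I⦄, u₁ ≤ u₂ → u₂ ≤ u₃ → u₃ ≤ u₄ → ∀ v,
    (c u₄ v - c u₃ v) * (u₂ - u₁) ≤ (c u₂ v - c u₁ v) * (u₄ - u₃)

theorem intervalwiseIncreasing_of_concaveFst {γ : Measure (ℝ × ℝ)} [IsFiniteMeasure γ]
    {c : I → I → ℝ} (hc : ConcaveFst c) {F G : ℝ → I} (hF : ∀ s, γ.fst.real (Iic s) = F s)
    (hFG : ∀ s t, γ.real (Iic s ×ˢ Iic t) = c (F s) (G t)) : IntervalwiseIncreasing γ := by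
  have hmono : Monotone F := fun s s' hs => Subtype.coe_le_coe.1 <| by
    simpa only [← hF] using measureReal_mono (Iic_subset_Iic.2 hs)
  rw [intervalwiseIncreasing_iff]
  intro a b c d hab hbc hcd t
  simpa only [hF, hFG] using hc (hmono hab) (hmono hbc) (hmono hcd) (G t)

theorem measure_prod_eq_fst {α β : Type*} [MeasurableSpace α] [MeasurableSpace β]
    {γ : Measure (α × β)} {V : Set α} (hV : MeasurableSet V) {W : Set β} (hW : MeasurableSet W)
    (hWc : γ.snd Wᶜ = 0) : γ (V ×ˢ W) = γ.fst V := by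
  rw [Measure.snd_apply hW.compl, preimage_compl] at hWc
  rw [Measure.fst_apply hV, prod_eq, measure_inter_conull hWc]

theorem HasDF.map_swap {γ : Measure (ℝ × ℝ)} {c : I → I → ℝ} (h : HasDF γ c) :
    HasDF (γ.map Prod.swap) fun u v => c v u := fun u v => by
  rw [map_measureReal_apply measurable_swap (measurableSet_Iic.prod measurableSet_Iic),
    preimage_swap_prod, h v u]

namespace Copula

/-- The copula of `(V, U)` when `C` is the copula of `(U, V)`. -/
def swap (C : Copula) : Copula where
  toFun u v := C.toFun v u
  exists_law := by
    obtain ⟨γ, _, hfst, hsnd, hγ⟩ := C.exists_law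
    exact ⟨γ.map Prod.swap, Measure.isProbabilityMeasure_map measurable_swap.aemeasurable,
      by rw [Measure.fst_map_swap, hsnd], by rw [Measure.snd_map_swap, hfst], hγ.map_swap⟩

variable (C : Copula)

theorem apply_one_right (u : I) : C.toFun u 1 = u := by
  obtain ⟨γ, _, hfst, hsnd, hγ⟩ := C.exists_law
  have hnull : γ.snd (Iic (1 : ℝ))ᶜ = 0 := by
    have hempty : Ioi 1 ∩ Icc 0 1 = (∅ : Set ℝ) :=
      eq_empty_of_forall_notMem fun x hx => (mem_Ioi.1 hx.1).not_ge hx.2.2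
    rw [hsnd, compl_Iic, Measure.restrict_apply measurableSet_Ioi, hempty, measure_empty]
  have hinter : Iic (u : ℝ) ∩ Icc 0 1 = Icc 0 (u : ℝ) := by
    rw [← Ici_inter_Iic, inter_left_comm, Iic_inter_Iic, inf_eq_left.2 u.2.2, Ici_inter_Iic]
  calc C.toFun u 1 = γ.real (Iic (u : ℝ) ×ˢ Iic (1 : ℝ)) := (hγ u 1).symm
    _ = γ.fst.real (Iic (u : ℝ)) := by
      simp only [measureReal_def, measure_prod_eq_fst measurableSet_Iic measurableSet_Iic hnull]
    _ = u := by
      rw [hfst, measureReal_restrict_apply measurableSet_Iic, hinter,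
        Real.volume_real_Icc_of_le u.2.1, sub_zero]

theorem apply_one_left (v : I) : C.toFun 1 v = v :=
  C.swap.apply_one_right v

variable {C} {γ : Measure (ℝ × ℝ)} [IsProbabilityMeasure γ]

theorem fst_real_Iic_of_hasDF (hγ : HasDF γ C.toFun) (u : I) : γ.fst.real (Iic (u : ℝ)) = u := by
  have hone : γ.real (Iic 1 ×ˢ Iic 1) = 1 := (hγ 1 1).trans (C.apply_one_right 1)
  have hnull : γ.snd (Iic (1 : ℝ))ᶜ = 0 := by
    refine (prob_compl_eq_zero_iff measurableSet_Iic).2 (le_antisymm prob_le_one ?_)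
    rw [Measure.snd_apply measurableSet_Iic, ← ENNReal.toReal_eq_one_iff _ |>.1 hone]
    exact measure_mono fun z hz => hz.2
  rw [measureReal_def, ← measure_prod_eq_fst measurableSet_Iic measurableSet_Iic hnull]
  exact (hγ u 1).trans (C.apply_one_right u)

theorem concaveFst_of_hasDF (hγ : HasDF γ C.toFun) (hinc : IntervalwiseIncreasing γ) :
    ConcaveFst C.toFun := by
  intro u₁ u₂ u₃ u₄ h₁₂ h₂₃ h₃₄ v
  simpa only [hγ _ v, fst_real_Iic_of_hasDF hγ] using
    intervalwiseIncreasing_iff.1 hinc h₁₂ h₂₃ h₃₄ v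

theorem IsSI.concaveFst (h : C.IsSI) : ConcaveFst C.toFun := by
  obtain ⟨γ, _, hγ, hinc⟩ := h
  exact concaveFst_of_hasDF hγ hinc.intervalwiseIncreasing

theorem IsCI.isSI (h : C.IsCI) : C.IsSI :=
  h.imp fun _ h => h.imp fun _ h => ⟨h.1, h.2.1⟩

theorem IsCI.swap_isSI (h : C.IsCI) : C.swap.IsSI := by
  obtain ⟨γ, _, hγ, _, hinc⟩ := h
  exact ⟨γ.map Prod.swap, Measure.isProbabilityMeasure_map measurable_swap.aemeasurable,
    hγ.map_swap, hinc⟩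

theorem IsSI.mul_le_apply (h : C.IsSI) (u v : I) : u * v ≤ C.toFun u v := by
  have hnonneg : 0 ≤ C.toFun 0 v := by
    obtain ⟨γ, _, hγ, _⟩ := h
    exact hγ 0 v ▸ measureReal_nonneg
  have hslope := h.concaveFst (unitInterval.nonneg' (t := u)) le_rfl unitInterval.le_one' v
  rw [C.apply_one_left, Icc.coe_zero, Icc.coe_one] at hslope
  nlinarith [mul_nonneg hnonneg (sub_nonneg.2 u.2.2)]

end Copula

/-! ### Monotone versions of conditional laws -/

theorem tendsto_measure_Ioc_sub_left (μ : Measure ℝ) [IsFiniteMeasure μ] (a b : ℝ) :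
    Filter.Tendsto (fun δ => μ (Ioc (a - δ) b)) (nhdsWithin 0 (Ioi 0)) (nhds (μ (Icc a b))) := by
  have hinter : ⋂ δ > (0 : ℝ), Ioc (a - δ) b = Icc a b := by
    ext x
    simp only [mem_iInter, mem_Ioc, mem_Icc, sub_lt_iff_lt_add]
    exact ⟨fun h => ⟨le_of_forall_pos_lt_add fun δ hδ => (h δ hδ).1, (h 1 one_pos).2⟩,
      fun h δ hδ => ⟨lt_add_of_le_of_pos h.1 hδ, h.2⟩⟩
  rw [← hinter]
  exact tendsto_measure_biInter_gt (fun _ _ => measurableSet_Ioc.nullMeasurableSet)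
    (fun _ _ _ hδ => Ioc_subset_Ioc_left (sub_le_sub_left hδ a)) ⟨1, one_pos, by finiteness⟩

theorem IntervalwiseIncreasing.measure_Icc_mul_le {γ : Measure (ℝ × ℝ)} [IsFiniteMeasure γ]
    (h : IntervalwiseIncreasing γ) {a b c d : ℝ} (hab : a ≤ b) (hbc : b < c) (hcd : c ≤ d) (t : ℝ) :
    γ (Icc c d ×ˢ Iic t) * γ.fst (Icc a b) ≤ γ (Icc a b ×ˢ Iic t) * γ.fst (Icc c d) := by
  have hlim (a b c d : ℝ) := ENNReal.Tendsto.mul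
    (tendsto_measure_Ioc_sub_left (γ.restrict (Prod.snd ⁻¹' Iic t)).fst a b) (.inr (by finiteness))
    (tendsto_measure_Ioc_sub_left γ.fst c d) (.inr (by finiteness))
  simp only [fst_restrict_preimage_snd_apply γ measurableSet_Ioc,
    fst_restrict_preimage_snd_apply γ measurableSet_Icc] at hlim
  refine le_of_tendsto_of_tendsto (hlim c d a b) (hlim a b c d) ?_
  filter_upwards [Ioc_mem_nhdsGT (sub_pos.2 hbc)] with δ hδ
  exact h (by linarith [hδ.1]) (by linarith [hδ.2]) (by linarith [hδ.1]) t

theorem tendsto_measure_closedBall_prod_div (γ : Measure (ℝ × ℝ)) [IsFiniteMeasure γ]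
    {W : Set ℝ} (hW : MeasurableSet W) :
    ∀ᵐ s ∂γ.fst, Filter.Tendsto
      (fun r => γ (Metric.closedBall s r ×ˢ W) / γ.fst (Metric.closedBall s r))
      (nhdsWithin 0 (Ioi 0)) (nhds (γ.condKernel s W)) := by
  have hfin : ∫⁻ s, γ.condKernel s W ∂γ.fst ≠ ⊤ := by
    rw [← setLIntegral_univ,
      Measure.setLIntegral_condKernel_eq_measure_prod MeasurableSet.univ hW]
    finiteness
  filter_upwards [(Besicovitch.vitaliFamily γ.fst).ae_tendsto_lintegral_div
    (Kernel.measurable_coe γ.condKernel hW).aemeasurable hfin] with s hs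
  simpa only [Function.comp_def, Measure.setLIntegral_condKernel_eq_measure_prod
    Metric.isClosed_closedBall.measurableSet hW] using
    hs.comp (Besicovitch.tendsto_filterAt γ.fst s)

theorem eventually_measure_closedBall_pos (μ : Measure ℝ) [IsFiniteMeasure μ] :
    ∀ᵐ s ∂μ, ∀ᶠ r in nhdsWithin 0 (Ioi 0), 0 < μ (Metric.closedBall s r) := by
  filter_upwards [(Besicovitch.vitaliFamily μ).ae_eventually_measure_pos] with s hs
  exact (Besicovitch.tendsto_filterAt μ s).eventually hs

/-- Differentiation of measures along closed balls turns the comparison of conditional probabilities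
given intervals into one of the conditional laws given points. -/
theorem IntervalwiseIncreasing.ae_condKernel_Iic_le {γ : Measure (ℝ × ℝ)} [IsFiniteMeasure γ]
    (h : IntervalwiseIncreasing γ) (t : ℝ) : ∃ T : Set ℝ, (∀ᵐ s ∂γ.fst, s ∈ T) ∧
      ∀ s ∈ T, ∀ s' ∈ T, s ≤ s' → γ.condKernel s' (Iic t) ≤ γ.condKernel s (Iic t) := by
  refine ⟨{s | Filter.Tendsto (fun r => γ (Metric.closedBall s r ×ˢ Iic t) /
      γ.fst (Metric.closedBall s r)) (nhdsWithin 0 (Ioi 0)) (nhds (γ.condKernel s (Iic t))) ∧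
    ∀ᶠ r in nhdsWithin 0 (Ioi 0), 0 < γ.fst (Metric.closedBall s r)},
    (tendsto_measure_closedBall_prod_div γ measurableSet_Iic).and
      (eventually_measure_closedBall_pos γ.fst), fun s hs s' hs' hle => ?_⟩
  rcases hle.eq_or_lt with rfl | hlt
  · exact le_rfl
  refine le_of_tendsto_of_tendsto hs'.1 hs.1 ?_
  filter_upwards [hs.2, hs'.2, Ioo_mem_nhdsGT (half_pos (sub_pos.2 hlt))] with r hpos hpos' hr
  rw [ENNReal.div_le_iff hpos'.ne' (by finiteness), ← ENNReal.mul_div_right_comm,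
    ENNReal.le_div_iff_mul_le (.inl hpos.ne') (.inl (by finiteness))]
  simp only [Real.closedBall_eq_Icc]
  exact h.measure_Icc_mul_le (by linarith [hr.1]) (by linarith [hr.2]) (by linarith [hr.1]) t

theorem measure_Iic_le_of_forall_rat {μ ν : Measure ℝ} [IsProbabilityMeasure μ]
    [IsProbabilityMeasure ν] (h : ∀ q : ℚ, μ (Iic (q : ℝ)) ≤ ν (Iic (q : ℝ))) (t : ℝ) :
    μ (Iic t) ≤ ν (Iic t) := by
  rw [← ofReal_cdf, ← ofReal_cdf, ← StieltjesFunction.iInf_rat_gt_eq (cdf μ),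
    ← StieltjesFunction.iInf_rat_gt_eq (cdf ν)]
  refine ENNReal.ofReal_le_ofReal (ciInf_mono ⟨0, ?_⟩ fun q => ?_)
  · rintro _ ⟨q, rfl⟩
    exact cdf_nonneg μ _
  · rw [cdf_eq_real, cdf_eq_real]
    exact ENNReal.toReal_mono (by finiteness) (h q)

theorem IntervalwiseIncreasing.exists_measurableSet_condKernel_Iic_le {γ : Measure (ℝ × ℝ)}
    [IsFiniteMeasure γ] (h : IntervalwiseIncreasing γ) :
    ∃ T : Set ℝ, MeasurableSet T ∧ γ.fst Tᶜ = 0 ∧ ∀ s ∈ T, ∀ s' ∈ T, s ≤ s' →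
      ∀ t, γ.condKernel s' (Iic t) ≤ γ.condKernel s (Iic t) := by
  choose T hT hmono using fun q : ℚ => h.ae_condKernel_Iic_le q
  obtain ⟨S, hsub, hSm, hS⟩ := exists_measurable_superset_of_null (ae_iff.1 (ae_all_iff.2 hT))
  have hST (s) (hs : s ∈ Sᶜ) (q : ℚ) : s ∈ T q := not_not.1 (fun h => hs (hsub h)) q
  refine ⟨Sᶜ, hSm.compl, by rwa [compl_compl], fun s hs s' hs' hle => ?_⟩
  exact measure_Iic_le_of_forall_rat fun q => hmono q s (hST s hs q) s' (hST s' hs' q) hle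

/-! ### Monotone kernels -/

/-- The law `κ s` increases with `s` in the stochastic order, tested on bounded functions. -/
def MonotoneKernel {α β : Type*} [MeasurableSpace α] [Preorder α] [MeasurableSpace β] [Preorder β]
    (κ : Kernel α β) : Prop :=
  ∀ ⦃φ : β → ℝ⦄ ⦃c : ℝ⦄, Measurable φ → (∀ x, |φ x| ≤ c) → Monotone φ →
    Monotone fun s => ∫ x, φ x ∂κ s

section Kernels

variable {α β γ : Type*} [MeasurableSpace α] [MeasurableSpace β] [MeasurableSpace γ]

theorem measurable_integral_kernel (κ : Kernel α β) [IsMarkovKernel κ] {f : β → ℝ}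
    (hf : Measurable f) : Measurable fun s => ∫ x, f x ∂κ s :=
  hf.stronglyMeasurable.integral_kernel.measurable

theorem integral_kernel_comp (η : Kernel β γ) [IsMarkovKernel η] (κ : Kernel α β)
    [IsMarkovKernel κ] {f : γ → ℝ} (hf : Measurable f) {c : ℝ} (hc : ∀ x, |f x| ≤ c) (s : α) :
    ∫ x, f x ∂(η ∘ₖ κ) s = ∫ y, ∫ x, f x ∂η y ∂κ s :=
  Kernel.integral_comp (integrable_of_forall_abs_le hf hc)

theorem integral_measure_comp (κ : Kernel α β) [IsMarkovKernel κ] (μ : Measure α)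
    [IsProbabilityMeasure μ] {f : β → ℝ} (hf : Measurable f) {c : ℝ} (hc : ∀ x, |f x| ≤ c) :
    ∫ x, f x ∂(κ ∘ₘ μ) = ∫ s, ∫ x, f x ∂κ s ∂μ := by
  rw [Measure.comp_eq_comp_const_apply, integral_kernel_comp _ _ hf hc, Kernel.const_apply]

theorem abs_integral_measure_comp_sub_le (κ κ' : Kernel α β) [IsMarkovKernel κ]
    [IsMarkovKernel κ'] (μ : Measure α) [IsProbabilityMeasure μ] {S : Set α}
    (hS : MeasurableSet S) {ε : ℝ} (hε : μ.real Sᶜ ≤ ε) (h : ∀ s ∈ S, κ s = κ' s)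
    {f : β → ℝ} (hf : Measurable f) {c : ℝ} (hc : ∀ x, |f x| ≤ c) :
    |∫ x, f x ∂(κ ∘ₘ μ) - ∫ x, f x ∂(κ' ∘ₘ μ)| ≤ c * (2 * ε) := by
  have hbound (κ : Kernel α β) [IsMarkovKernel κ] (s : α) : |∫ x, f x ∂κ s| ≤ c :=
    abs_integral_le_of_forall_abs_le hc
  have hint (κ : Kernel α β) [IsMarkovKernel κ] : Integrable (fun s => ∫ x, f x ∂κ s) μ :=
    integrable_of_forall_abs_le (measurable_integral_kernel κ hf) (hbound κ)
  obtain ⟨s₀⟩ : Nonempty α := μ.nonempty_of_neZero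
  have hc₀ : 0 ≤ c := (abs_nonneg _).trans (hbound κ s₀)
  rw [integral_measure_comp κ μ hf hc, integral_measure_comp κ' μ hf hc,
    ← integral_sub (hint κ) (hint κ')]
  calc |∫ s, (∫ x, f x ∂κ s - ∫ x, f x ∂κ' s) ∂μ|
      ≤ ∫ s, |∫ x, f x ∂κ s - ∫ x, f x ∂κ' s| ∂μ := abs_integral_le_integral_abs
    _ ≤ ∫ s, Sᶜ.indicator (fun _ => 2 * c) s ∂μ := by
      refine integral_mono ((hint κ).sub (hint κ')).abs
        ((integrable_const _).indicator hS.compl) fun s => ?_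
      by_cases hs : s ∈ S
      · rw [indicator_of_notMem (notMem_compl_iff.2 hs), h s hs, sub_self, abs_zero]
      · rw [indicator_of_mem (mem_compl hs)]
        exact (abs_sub _ _).trans (by linarith [hbound κ s, hbound κ' s])
    _ = c * (2 * μ.real Sᶜ) := by
      rw [integral_indicator_const _ hS.compl, smul_eq_mul]
      ring
    _ ≤ c * (2 * ε) := by gcongr

namespace MonotoneKernel

variable [Preorder α] [Preorder β] [Preorder γ]

theorem comp {η : Kernel β γ} [IsMarkovKernel η] {κ : Kernel α β} [IsMarkovKernel κ]
    (hη : MonotoneKernel η) (hκ : MonotoneKernel κ) : MonotoneKernel (η ∘ₖ κ) := by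
  intro φ c hφ hc hmono
  simp only [integral_kernel_comp η κ hφ hc]
  exact hκ (measurable_integral_kernel η hφ) (fun _ => abs_integral_le_of_forall_abs_le hc)
    (hη hφ hc hmono)

theorem comap {κ : Kernel β γ} (hκ : MonotoneKernel κ) {f : α → β} (hf : Monotone f)
    (hfm : Measurable f) : MonotoneKernel (κ.comap f hfm) :=
  fun _ _ hφ hc hmono => (hκ hφ hc hmono).comp hf

theorem deterministic {f : α → β} (hf : Monotone f) (hfm : Measurable f) :
    MonotoneKernel (Kernel.deterministic f hfm) := by
  intro φ c hφ _ hmono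
  simp only [Kernel.deterministic_apply, integral_dirac' _ _ hφ.stronglyMeasurable]
  exact hmono.comp hf

theorem id : MonotoneKernel (Kernel.id : Kernel α α) :=
  deterministic monotone_id measurable_id

theorem of_measure_Iic_le {κ : Kernel α ℝ} [IsMarkovKernel κ]
    (h : ∀ ⦃s s'⦄, s ≤ s' → ∀ t, κ s' (Iic t) ≤ κ s (Iic t)) : MonotoneKernel κ :=
  fun _ _ _ hc hmono s s' hs =>
    integral_le_of_measure_Iic_le (by rw [measure_univ, measure_univ]) (h hs) hmono hc

end MonotoneKernel

end Kernels

/-- The kernel `K` agrees with monotone kernels outside sets of arbitrarily small `α`-mass. -/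
def NearlyMonotone (α : Measure ℝ) (K : Kernel ℝ ℝ) : Prop :=
  ∀ ε > 0, ∃ K' : Kernel ℝ ℝ, IsMarkovKernel K' ∧ MonotoneKernel K' ∧
    ∃ S, MeasurableSet S ∧ α.real Sᶜ ≤ ε ∧ ∀ s ∈ S, K' s = K s

/-- The conditional laws increase along a set of full measure. Composing them with a monotone
retraction onto a compact subset of almost full measure gives a globally monotone kernel. -/
theorem IntervalwiseIncreasing.nearlyMonotone {γ : Measure (ℝ × ℝ)} [IsProbabilityMeasure γ]
    (h : IntervalwiseIncreasing γ) : NearlyMonotone γ.fst γ.condKernel := by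
  obtain ⟨T, hTm, hT₀, hT⟩ := h.exists_measurableSet_condKernel_Iic_le
  intro ε hε
  obtain ⟨t₀, ht₀⟩ : T.Nonempty := by
    by_contra hempty
    rw [not_nonempty_iff_eq_empty.1 hempty, compl_empty, measure_univ] at hT₀
    exact one_ne_zero hT₀
  obtain ⟨C, hCT, hC, hlt⟩ := hTm.exists_isCompact_sdiff_lt (measure_ne_top γ.fst T)
    (ENNReal.ofReal_pos.2 hε).ne'
  obtain ⟨π, hπ, hπmem, hπeq⟩ :=
    exists_monotone_retraction (hC.insert t₀).isClosed (insert_nonempty t₀ C)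
  have hπT (t : ℝ) : π t ∈ T := insert_subset ht₀ hCT (hπmem t)
  refine ⟨γ.condKernel.comap π hπ.measurable, inferInstance, ?_, C, hC.measurableSet, ?_, ?_⟩
  · exact .of_measure_Iic_le fun s s' hs t => hT _ (hπT s) _ (hπT s') (hπ hs) t
  · refine ENNReal.toReal_le_of_le_ofReal hε.le ?_
    have hsub : Cᶜ ⊆ Tᶜ ∪ T \ C := fun x hx => (em (x ∈ T)).symm.imp mem_compl fun h => ⟨h, hx⟩
    calc γ.fst Cᶜ ≤ γ.fst Tᶜ + γ.fst (T \ C) := (measure_mono hsub).trans (measure_union_le _ _)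
      _ ≤ ENNReal.ofReal ε := by
        rw [hT₀, zero_add]
        exact hlt.le
  · intro s hs
    rw [Kernel.comap_apply, hπeq s (mem_insert_of_mem _ hs)]

/-! ### Resampling a coordinate -/

/-- The laws `μ` and `ν` of random vectors are `ε`-close in total variation on the coordinates
in `A`. -/
def CloseOn {N : Type*} (A : Set N) (ε : ℝ) (μ ν : Measure (N → ℝ)) : Prop :=
  ∀ ⦃ψ : (N → ℝ) → ℝ⦄ ⦃c : ℝ⦄, Measurable ψ → (∀ x, |ψ x| ≤ c) → DependsOn ψ A →
    |∫ x, ψ x ∂μ - ∫ x, ψ x ∂ν| ≤ c * ε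

section Resampling

variable {N α : Type*} [MeasurableSpace α]

theorem CloseOn.trans {A : Set N} {μ ν ρ : Measure (N → ℝ)} {δ ε : ℝ} (h : CloseOn A δ μ ν)
    (h' : CloseOn A ε ν ρ) : CloseOn A (δ + ε) μ ρ := fun ψ c hψ hc hA => by
  rw [mul_add]
  exact (abs_sub_le _ _ _).trans (add_le_add (h hψ hc hA) (h' hψ hc hA))

theorem closeOn_comp_of_eq_on {κ κ' : Kernel α (N → ℝ)} [IsMarkovKernel κ] [IsMarkovKernel κ']
    (A : Set N) {μ : Measure α} [IsProbabilityMeasure μ] {S : Set α} (hS : MeasurableSet S) {ε : ℝ}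
    (hε : μ.real Sᶜ ≤ ε) (h : ∀ s ∈ S, κ s = κ' s) : CloseOn A (2 * ε) (κ ∘ₘ μ) (κ' ∘ₘ μ) :=
  fun _ _ hψ hc _ => abs_integral_measure_comp_sub_le κ κ' μ hS hε h hψ hc

variable [DecidableEq N]

open Function

/-- Draws `x` from `κ a` and independently `y` from `η a`, and replaces the coordinate `j` of `x`
by `y`. -/
noncomputable def updateKernel (κ : Kernel α (N → ℝ)) (η : Kernel α ℝ) (j : N) :
    Kernel α (N → ℝ) :=
  (κ ×ₖ η).map fun z => update z.1 j z.2

/-- Replaces the coordinate `j` of a vector by a draw from `K` started at the coordinate `p`. -/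
noncomputable def resampleKernel (K : Kernel ℝ ℝ) (p j : N) : Kernel (N → ℝ) (N → ℝ) :=
  updateKernel Kernel.id (K.comap (fun x => x p) (measurable_pi_apply p)) j

instance (κ : Kernel α (N → ℝ)) [IsMarkovKernel κ] (η : Kernel α ℝ) [IsMarkovKernel η] (j : N) :
    IsMarkovKernel (updateKernel κ η j) :=
  Kernel.IsMarkovKernel.map _ measurable_update'

instance (K : Kernel ℝ ℝ) [IsMarkovKernel K] (p j : N) : IsMarkovKernel (resampleKernel K p j) :=
  inferInstanceAs (IsMarkovKernel (updateKernel _ _ _))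

theorem integral_updateKernel (κ : Kernel α (N → ℝ)) [IsMarkovKernel κ] (η : Kernel α ℝ)
    [IsMarkovKernel η] (j : N) (a : α) {g : (N → ℝ) → ℝ} (hg : Measurable g) {c : ℝ}
    (hc : ∀ x, |g x| ≤ c) :
    ∫ x, g x ∂updateKernel κ η j a = ∫ x, ∫ y, g (update x j y) ∂η a ∂κ a := by
  rw [updateKernel, Kernel.map_apply _ measurable_update', Kernel.prod_apply,
    integral_map measurable_update'.aemeasurable hg.aestronglyMeasurable, integral_prod]
  exact integrable_of_forall_abs_le (hg.comp measurable_update') fun _ => hc _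

theorem monotone_update {x x' : N → ℝ} (h : x ≤ x') (j : N) {y y' : ℝ} (hy : y ≤ y') :
    update x j y ≤ update x' j y' :=
  update_le_update_iff.2 ⟨hy, fun i _ => h i⟩

theorem MonotoneKernel.updateKernel [Preorder α] {κ : Kernel α (N → ℝ)} [IsMarkovKernel κ]
    {η : Kernel α ℝ} [IsMarkovKernel η] (hκ : MonotoneKernel κ) (hη : MonotoneKernel η) (j : N) :
    MonotoneKernel (updateKernel κ η j) := by
  intro φ c hφ hc hmono a a' ha
  have hint (x : N → ℝ) (b : α) : Integrable (fun y => φ (update x j y)) (η b) :=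
    integrable_of_forall_abs_le (hφ.comp (measurable_update x)) fun _ => hc _
  have hmeas (b : α) : Measurable fun x => ∫ y, φ (update x j y) ∂η b :=
    (hφ.comp measurable_update').stronglyMeasurable.integral_prod_right'.measurable
  have hbound (b : α) (x : N → ℝ) : |∫ y, φ (update x j y) ∂η b| ≤ c :=
    abs_integral_le_of_forall_abs_le fun _ => hc _
  simp only [integral_updateKernel κ η j _ hφ hc]
  calc ∫ x, ∫ y, φ (update x j y) ∂η a ∂κ a
      ≤ ∫ x, ∫ y, φ (update x j y) ∂η a' ∂κ a :=
        integral_mono (integrable_of_forall_abs_le (hmeas a) (hbound a))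
          (integrable_of_forall_abs_le (hmeas a') (hbound a')) fun x =>
          hη (hφ.comp (measurable_update x)) (fun _ => hc _)
            (fun y y' hy => hmono (monotone_update le_rfl j hy)) ha
    _ ≤ ∫ x, ∫ y, φ (update x j y) ∂η a' ∂κ a' :=
        hκ (hmeas a') (hbound a') (fun x x' hx => integral_mono (hint x a') (hint x' a')
          fun y => hmono (monotone_update hx j le_rfl)) ha

theorem MonotoneKernel.resampleKernel {K : Kernel ℝ ℝ} [IsMarkovKernel K] (hK : MonotoneKernel K)
    (p j : N) : MonotoneKernel (resampleKernel K p j) :=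
  MonotoneKernel.id.updateKernel (hK.comap (monotone_eval p) (measurable_pi_apply p)) j

theorem updateKernel_id_apply (κ : Kernel ℝ (N → ℝ)) [IsMarkovKernel κ] (j : N) (t : ℝ) :
    updateKernel κ Kernel.id j t = (κ t).map fun x => update x j t := by
  rw [updateKernel, Kernel.map_apply _ measurable_update', Kernel.prod_apply, Kernel.id_apply,
    Measure.prod_dirac, Measure.map_map measurable_update' measurable_prodMk_right]
  rfl

variable (K : Kernel ℝ ℝ) [IsMarkovKernel K] (p j : N)

theorem resampleKernel_apply (x : N → ℝ) : resampleKernel K p j x = (K (x p)).map (update x j) := by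
  rw [resampleKernel, updateKernel, Kernel.map_apply _ measurable_update', Kernel.prod_apply,
    Kernel.id_apply, Measure.dirac_prod, Measure.map_map measurable_update' measurable_prodMk_left]
  rfl

variable {g : (N → ℝ) → ℝ} {c : ℝ}

theorem integral_resampleKernel (hg : Measurable g) (x : N → ℝ) :
    ∫ z, g z ∂resampleKernel K p j x = ∫ y, g (update x j y) ∂K (x p) := by
  rw [resampleKernel_apply,
    integral_map (measurable_update x).aemeasurable hg.aestronglyMeasurable]

variable {p} in
theorem dependsOn_integral_resampleKernel {A : Set N} (hp : p ∈ A) (hg : Measurable g)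
    (hA : DependsOn g (insert j A)) : DependsOn (fun x => ∫ z, g z ∂resampleKernel K p j x) A := by
  intro x x' h
  simp only [integral_resampleKernel K p j hg, h p hp]
  congr 1 with y
  refine hA fun i hi => ?_
  rcases eq_or_ne i j with rfl | hij
  · rw [update_self, update_self]
  · rw [update_of_ne hij, update_of_ne hij, h i (mem_of_mem_insert_of_ne hi hij)]

variable {p} in
theorem CloseOn.resampleKernel {A : Set N} {μ ν : Measure (N → ℝ)} [IsProbabilityMeasure μ]
    [IsProbabilityMeasure ν] {ε : ℝ} (h : CloseOn A ε μ ν) (hp : p ∈ A) :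
    CloseOn (insert j A) ε (resampleKernel K p j ∘ₘ μ) (resampleKernel K p j ∘ₘ ν) := by
  intro ψ c hψ hc hA
  rw [integral_measure_comp _ μ hψ hc, integral_measure_comp _ ν hψ hc]
  exact h (measurable_integral_kernel _ hψ) (fun _ => abs_integral_le_of_forall_abs_le hc)
    (dependsOn_integral_resampleKernel K j hp hψ hA)

variable {K p j}

theorem Supermodular.update_sub_le_update_sub (hg : Supermodular g) {x x' : N → ℝ} (h : x ≤ x')
    {y y' : ℝ} (hy : y ≤ y') :
    g (update x j y') - g (update x j y) ≤ g (update x' j y') - g (update x' j y) := by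
  have hinf : update x j y' ⊓ update x' j y = update x j y := by
    ext i
    rcases eq_or_ne i j with rfl | hij <;> simp [*, h i]
  have hsup : update x j y' ⊔ update x' j y = update x' j y' := by
    ext i
    rcases eq_or_ne i j with rfl | hij <;> simp [*, h i]
  have hsm := hg (update x j y') (update x' j y)
  rw [hinf, hsup] at hsm
  linarith

theorem Supermodular.update_add_le_update_add (hg : Supermodular g) (x x' : N → ℝ) (y : ℝ) :
    g (update x j y) + g (update x' j y) ≤
      g (update (x ⊓ x') j y) + g (update (x ⊔ x') j y) := by
  have hinf : update x j y ⊓ update x' j y = update (x ⊓ x') j y := by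
    ext i
    rcases eq_or_ne i j with rfl | hij <;> simp [*]
  have hsup : update x j y ⊔ update x' j y = update (x ⊔ x') j y := by
    ext i
    rcases eq_or_ne i j with rfl | hij <;> simp [*]
  exact hinf ▸ hsup ▸ hg _ _

theorem Supermodular.integral_resampleKernel (hK : MonotoneKernel K) (hg : Supermodular g)
    (hgm : Measurable g) (hc : ∀ x, |g x| ≤ c) :
    Supermodular fun x => ∫ z, g z ∂resampleKernel K p j x := by
  have hm (x : N → ℝ) : Measurable fun y => g (update x j y) := hgm.comp (measurable_update x)
  have hint (x : N → ℝ) (s : ℝ) : Integrable (fun y => g (update x j y)) (K s) :=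
    integrable_of_forall_abs_le (hm x) fun _ => hc _
  have of_le (x x' : N → ℝ) (h : x p ≤ x' p) :
      ∫ z, g z ∂resampleKernel K p j x + ∫ z, g z ∂resampleKernel K p j x' ≤
        ∫ z, g z ∂resampleKernel K p j (x ⊓ x') + ∫ z, g z ∂resampleKernel K p j (x ⊔ x') := by
    have hinf : (x ⊓ x') p = x p := inf_of_le_left h
    have hsup : (x ⊔ x') p = x' p := sup_of_le_right h
    simp only [_root_.integral_resampleKernel K p j hgm, hinf, hsup]
    have hpoint := integral_mono ((hint x (x p)).add (hint x' (x p)))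
      ((hint (x ⊓ x') (x p)).add (hint (x ⊔ x') (x p))) (hg.update_add_le_update_add x x')
    have hkernel := hK ((hm (x ⊔ x')).sub (hm x'))
      (fun y => (abs_sub _ _).trans (add_le_add (hc _) (hc _)))
      (fun y y' hy => by
        have := hg.update_sub_le_update_sub (j := j) (le_sup_right : x' ≤ x ⊔ x') hy
        simp only [Pi.sub_apply]
        linarith) h
    simp only [Pi.add_apply, Pi.sub_apply] at hpoint hkernel
    rw [integral_add (hint _ _) (hint _ _), integral_add (hint _ _) (hint _ _)] at hpoint
    rw [integral_sub (hint _ _) (hint _ _), integral_sub (hint _ _) (hint _ _)] at hkernel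
    linarith
  intro x x'
  rcases le_total (x p) (x' p) with h | h
  · exact of_le x x' h
  · rw [add_comm, inf_comm, sup_comm]
    exact of_le x' x h

end Resampling

/-! ### Monotone conditional laws -/

section MonotoneConditional

variable {N : Type*}

/-- The joint law of the coordinates `i` and `j`. -/
noncomputable def pairLaw (μ : Measure (N → ℝ)) (i j : N) : Measure (ℝ × ℝ) :=
  μ.map fun x => (x i, x j)

theorem measurable_pair (i j : N) : Measurable fun x : N → ℝ => (x i, x j) :=
  (measurable_pi_apply i).prodMk (measurable_pi_apply j)

instance (μ : Measure (N → ℝ)) [IsProbabilityMeasure μ] (i j : N) :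
    IsProbabilityMeasure (pairLaw μ i j) :=
  Measure.isProbabilityMeasure_map (measurable_pair i j).aemeasurable

instance (μ : Measure (N → ℝ)) [IsProbabilityMeasure μ] (i : N) :
    IsProbabilityMeasure (μ.map fun x => x i) :=
  Measure.isProbabilityMeasure_map (measurable_pi_apply i).aemeasurable

theorem fst_pairLaw (μ : Measure (N → ℝ)) (i j : N) : (pairLaw μ i j).fst = μ.map fun x => x i :=
  Measure.fst_map_prodMk (measurable_pi_apply j)

theorem snd_pairLaw (μ : Measure (N → ℝ)) (i j : N) : (pairLaw μ i j).snd = μ.map fun x => x j :=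
  Measure.snd_map_prodMk (measurable_pi_apply i)

theorem map_swap_pairLaw (μ : Measure (N → ℝ)) (i j : N) :
    (pairLaw μ i j).map Prod.swap = pairLaw μ j i :=
  Measure.map_map measurable_swap (measurable_pair i j)

theorem compProd_condKernel_pairLaw (μ : Measure (N → ℝ)) [IsProbabilityMeasure μ] (i j : N) :
    (μ.map fun x => x i) ⊗ₘ (pairLaw μ i j).condKernel = pairLaw μ i j := by
  rw [← fst_pairLaw μ i j, Measure.disintegrate]

theorem measure_eq_of_forall_integral_eq {α : Type*} [MeasurableSpace α] {μ ν : Measure α}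
    [IsProbabilityMeasure μ] [IsProbabilityMeasure ν]
    (h : ∀ (f : α → ℝ) (c : ℝ), Measurable f → (∀ x, |f x| ≤ c) → ∫ x, f x ∂μ = ∫ x, f x ∂ν) :
    μ = ν := by
  ext s hs
  have hs' := h (s.indicator 1) 1 (measurable_one.indicator hs) fun x => by
    by_cases hx : x ∈ s <;> simp [hx]
  rwa [integral_indicator_one hs, integral_indicator_one hs, measureReal_def, measureReal_def,
    ENNReal.toReal_eq_toReal_iff' (measure_ne_top _ _) (measure_ne_top _ _)] at hs'

/-- The kernel `κ` gives increasing laws of the whole vector given the coordinate `p`, whose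
mixture is the law of the coordinates in `A` up to `ε` in total variation: approximately, these
coordinates are jointly stochastically increasing in the coordinate `p`. -/
structure IsMonotoneConditional (μ : Measure (N → ℝ)) (A : Set N) (p : N) (ε : ℝ)
    (κ : Kernel ℝ (N → ℝ)) : Prop where
  ae_eq : ∀ s, ∀ᵐ x ∂κ s, x p = s
  mono : MonotoneKernel κ
  closeOn : CloseOn A ε μ (κ ∘ₘ μ.map fun x => x p)

theorem measurable_functionConst : Measurable (Function.const N : ℝ → N → ℝ) :=
  measurable_pi_lambda _ fun _ => measurable_id

theorem measurableSet_coord_eq (i : N) (s : ℝ) : MeasurableSet {x : N → ℝ | x i = s} :=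
  measurableSet_eq_fun (measurable_pi_apply i) measurable_const

theorem integral_eq_integral_const {μ : Measure (N → ℝ)} {r : N} {ψ : (N → ℝ) → ℝ}
    (hψ : Measurable ψ) (hr : DependsOn ψ {r}) :
    ∫ x, ψ x ∂μ = ∫ s, ψ (Function.const N s) ∂μ.map fun x => x r := by
  rw [integral_map (measurable_pi_apply r).aemeasurable
    (hψ.comp measurable_functionConst).aestronglyMeasurable]
  congr 1 with x
  exact hr fun i hi => by rw [mem_singleton_iff.1 hi, Function.const_apply]

theorem isMonotoneConditional_singleton (μ : Measure (N → ℝ)) [IsProbabilityMeasure μ] (r : N)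
    {ε : ℝ} (hε : 0 ≤ ε) : IsMonotoneConditional μ {r} r ε
      (Kernel.deterministic (Function.const N) measurable_functionConst) where
  ae_eq s := by
    rw [Kernel.deterministic_apply]
    exact (ae_dirac_iff (measurableSet_coord_eq r s)).2 rfl
  mono := .deterministic Function.const_mono measurable_functionConst
  closeOn ψ c hψ hc hr := by
    rw [integral_measure_comp _ _ hψ hc, integral_eq_integral_const hψ hr]
    simp only [Kernel.deterministic_apply, integral_dirac' _ _ hψ.stronglyMeasurable, sub_self,
      abs_zero]
    exact mul_nonneg ((abs_nonneg _).trans (hc 0)) hε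

open Function

variable [DecidableEq N]

/-- Given the coordinate `p`, the coordinate `j` is independent of the coordinates in `A`: the law
of the coordinates in `insert j A` does not change when `j` is drawn anew given `p` alone. -/
def IsMarkovStep (μ : Measure (N → ℝ)) [IsProbabilityMeasure μ] (A : Set N) (p j : N) : Prop :=
  CloseOn (insert j A) 0 μ (resampleKernel (pairLaw μ p j).condKernel p j ∘ₘ μ)

/-- Draws a vector from `κ s` and sets its coordinate `j` to `t`, starting from `(s, t)`. -/
noncomputable def sliceKernel (κ : Kernel ℝ (N → ℝ)) (j : N) : Kernel (ℝ × ℝ) (N → ℝ) :=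
  updateKernel (κ.comap Prod.fst measurable_fst) (.deterministic Prod.snd measurable_snd) j

variable {μ : Measure (N → ℝ)} {A : Set N} {p j : N} {ε : ℝ} {κ : Kernel ℝ (N → ℝ)}
  [IsMarkovKernel κ]

instance : IsMarkovKernel (sliceKernel κ j) :=
  inferInstanceAs (IsMarkovKernel (updateKernel _ _ _))

theorem integral_sliceKernel {ψ : (N → ℝ) → ℝ} (hψ : Measurable ψ) {c : ℝ} (hc : ∀ x, |ψ x| ≤ c)
    (z : ℝ × ℝ) : ∫ x, ψ x ∂sliceKernel κ j z = ∫ x, ψ (update x j z.2) ∂κ z.1 := by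
  rw [sliceKernel, integral_updateKernel _ _ _ _ hψ hc]
  simp only [Kernel.deterministic_apply, Kernel.comap_apply]
  congr 1 with x
  exact integral_dirac' _ _ (hψ.comp (measurable_update x)).stronglyMeasurable

theorem MonotoneKernel.increasingDifferences_integral_sliceKernel (hκ : MonotoneKernel κ)
    {ψ : (N → ℝ) → ℝ} (hψ : Measurable ψ) {c : ℝ} (hc : ∀ x, |ψ x| ≤ c) (hsm : Supermodular ψ) :
    IncreasingDifferences fun z => ∫ x, ψ x ∂sliceKernel κ j z := by
  intro s s' t t' hs ht
  have hm (t : ℝ) : Measurable fun x : N → ℝ => ψ (update x j t) :=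
    hψ.comp measurable_update_left
  have hint (s t : ℝ) : Integrable (fun x : N → ℝ => ψ (update x j t)) (κ s) :=
    integrable_of_forall_abs_le (hm t) fun _ => hc _
  have h := hκ ((hm t').sub (hm t)) (fun x => (abs_sub _ _).trans (add_le_add (hc _) (hc _)))
    (fun x x' hx => hsm.update_sub_le_update_sub hx ht) hs
  simp only [Pi.sub_apply] at h
  rw [integral_sub (hint _ _) (hint _ _), integral_sub (hint _ _) (hint _ _)] at h
  simp only [integral_sliceKernel hψ hc]
  linarith

theorem sliceKernel_comp_compProd (hκ : ∀ s, ∀ᵐ x ∂κ s, x p = s) (K : Kernel ℝ ℝ)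
    [IsMarkovKernel K] (ν : Measure ℝ) [IsProbabilityMeasure ν] :
    sliceKernel κ j ∘ₘ (ν ⊗ₘ K) = resampleKernel K p j ∘ₘ (κ ∘ₘ ν) := by
  refine measure_eq_of_forall_integral_eq fun ψ c hψ hc => ?_
  have hbound (x : N → ℝ) : |∫ z, ψ z ∂resampleKernel K p j x| ≤ c :=
    abs_integral_le_of_forall_abs_le hc
  rw [integral_measure_comp _ _ hψ hc, integral_measure_comp _ _ hψ hc,
    integral_measure_comp _ _ (measurable_integral_kernel _ hψ) hbound,
    Measure.integral_compProd (integrable_of_forall_abs_le (measurable_integral_kernel _ hψ)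
      fun _ => abs_integral_le_of_forall_abs_le hc)]
  congr 1 with s
  simp only [integral_sliceKernel hψ hc, integral_resampleKernel K p j hψ]
  have hψj : Measurable fun z : ℝ × (N → ℝ) => ψ (update z.2 j z.1) :=
    hψ.comp (measurable_update'.comp measurable_swap)
  rw [integral_integral_swap (f := fun y x => ψ (update x j y))
    (integrable_of_forall_abs_le hψj fun _ => hc _)]
  refine integral_congr_ae ?_
  filter_upwards [hκ s] with x hx
  rw [hx]

theorem sliceKernel_comp_map_swap (K : Kernel ℝ ℝ) [IsMarkovKernel K] (ν : Measure ℝ)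
    [IsProbabilityMeasure ν] :
    sliceKernel κ j ∘ₘ (ν ⊗ₘ K).map Prod.swap = updateKernel (κ ∘ₖ K) Kernel.id j ∘ₘ ν := by
  have : IsProbabilityMeasure ((ν ⊗ₘ K).map Prod.swap) :=
    Measure.isProbabilityMeasure_map measurable_swap.aemeasurable
  refine measure_eq_of_forall_integral_eq fun ψ c hψ hc => ?_
  have hm := measurable_integral_kernel (sliceKernel κ j) hψ
  rw [integral_measure_comp _ _ hψ hc, integral_measure_comp _ _ hψ hc,
    integral_map measurable_swap.aemeasurable hm.aestronglyMeasurable,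
    Measure.integral_compProd (f := fun z => ∫ x, ψ x ∂sliceKernel κ j z.swap)
      (integrable_of_forall_abs_le (hm.comp measurable_swap)
        fun _ => abs_integral_le_of_forall_abs_le hc)]
  congr 1 with t
  have hψt : Measurable fun x : N → ℝ => ψ (update x j t) := hψ.comp measurable_update_left
  rw [updateKernel_id_apply, integral_map measurable_update_left.aemeasurable
    hψ.aestronglyMeasurable, integral_kernel_comp _ _ hψt fun _ => hc _]
  simp only [integral_sliceKernel hψ hc, Prod.swap]

namespace IsMonotoneConditional

variable [IsProbabilityMeasure μ]

theorem closeOn_resampleKernel (hκ : IsMonotoneConditional μ A p ε κ) (hp : p ∈ A)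
    (K : Kernel ℝ ℝ) [IsMarkovKernel K] :
    CloseOn (insert j A) ε (resampleKernel K p j ∘ₘ μ)
      (sliceKernel κ j ∘ₘ ((μ.map fun x => x p) ⊗ₘ K)) := by
  rw [sliceKernel_comp_compProd hκ.ae_eq]
  exact hκ.closeOn.resampleKernel K j hp

theorem closeOn_sliceKernel_pairLaw (hκ : IsMonotoneConditional μ A p ε κ) (hp : p ∈ A)
    (hstep : IsMarkovStep μ A p j) :
    CloseOn (insert j A) ε μ (sliceKernel κ j ∘ₘ pairLaw μ p j) := by
  have h := hstep.trans (hκ.closeOn_resampleKernel hp (pairLaw μ p j).condKernel)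
  rwa [zero_add, compProd_condKernel_pairLaw] at h

theorem exists_insert (hκ : IsMonotoneConditional μ A p ε κ) (hε : 0 < ε) {q : N} (hq : q ∈ A)
    (hpj : p ≠ j) (hstep : IsMarkovStep μ A q j)
    (hK : NearlyMonotone (μ.map fun x => x q) (pairLaw μ q j).condKernel) :
    ∃ κ' : Kernel ℝ (N → ℝ), IsMarkovKernel κ' ∧
      IsMonotoneConditional μ (insert j A) p (3 * ε) κ' := by
  obtain ⟨K, _, hmono, S, hS, hSε, hSK⟩ := hK ε hε
  refine ⟨resampleKernel K q j ∘ₖ κ, inferInstance, fun s => ?_,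
    (hmono.resampleKernel q j).comp hκ.mono, ?_⟩
  · have hms := measurableSet_coord_eq p s
    refine Kernel.ae_comp_of_ae_ae hms ?_
    filter_upwards [hκ.ae_eq s] with x hx
    rw [resampleKernel_apply, ae_map_iff (measurable_update x).aemeasurable hms]
    exact Filter.Eventually.of_forall fun y => (update_of_ne hpj y x).trans hx
  · have hq_meas := measurable_pi_apply (X := fun _ : N => ℝ) q
    rw [map_measureReal_apply hq_meas hS.compl] at hSε
    have hswitch : CloseOn (insert j A) (2 * ε)
        (resampleKernel (pairLaw μ q j).condKernel q j ∘ₘ μ) (resampleKernel K q j ∘ₘ μ) :=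
      closeOn_comp_of_eq_on _ (hq_meas hS) hSε fun x hx => by
        rw [resampleKernel_apply, resampleKernel_apply, hSK _ hx]
    convert hstep.trans (hswitch.trans (hκ.closeOn.resampleKernel K j hq)) using 1
    · ring
    · rw [Measure.comp_assoc]

theorem exists_insert_self (hκ : IsMonotoneConditional μ A p ε κ) (hε : 0 < ε) (hp : p ∈ A)
    (hstep : IsMarkovStep μ A p j)
    (hK : NearlyMonotone (μ.map fun x => x j) (pairLaw μ j p).condKernel) :
    ∃ κ' : Kernel ℝ (N → ℝ), IsMarkovKernel κ' ∧
      IsMonotoneConditional μ (insert j A) j (3 * ε) κ' := by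
  obtain ⟨K, _, hmono, S, hS, hSε, hSK⟩ := hK ε hε
  refine ⟨updateKernel (κ ∘ₖ K) Kernel.id j, inferInstance, fun t => ?_,
    (hκ.mono.comp hmono).updateKernel .id j, ?_⟩
  · rw [updateKernel_id_apply, ae_map_iff measurable_update_left.aemeasurable
      (measurableSet_coord_eq j t)]
    exact Filter.Eventually.of_forall fun x => update_self j t x
  · have hslice := hκ.closeOn_sliceKernel_pairLaw hp hstep
    rw [← map_swap_pairLaw μ j p, ← compProd_condKernel_pairLaw μ j p,
      sliceKernel_comp_map_swap] at hslice
    have hswitch : CloseOn (insert j A) (2 * ε)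
        (updateKernel (κ ∘ₖ (pairLaw μ j p).condKernel) Kernel.id j ∘ₘ μ.map fun x => x j)
        (updateKernel (κ ∘ₖ K) Kernel.id j ∘ₘ μ.map fun x => x j) :=
      closeOn_comp_of_eq_on _ hS hSε fun t ht => by
        rw [updateKernel_id_apply, updateKernel_id_apply, Kernel.comp_apply, Kernel.comp_apply,
          hSK t ht]
    convert hslice.trans hswitch using 1
    ring

end IsMonotoneConditional

end MonotoneConditional

/-! ### Comparison along a rooted tree -/

section TreeComparison

variable {N : Type*}

/-- The bounded measurable supermodular functions of the coordinates in `A`, by which laws of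
random vectors are compared before unbounded functions are admitted. -/
structure IsSupermodularTest (A : Set N) (g : (N → ℝ) → ℝ) : Prop where
  measurable : Measurable g
  bounded : ∃ c, ∀ x, |g x| ≤ c
  supermodular : Supermodular g
  dependsOn : DependsOn g A

/-- Every edge law is increasing, in the direction of the edge. -/
def IsIncreasingAlong (E : N → N → Prop) (μ : Measure (N → ℝ)) : Prop :=
  ∀ ⦃i j⦄, E i j → IntervalwiseIncreasing (pairLaw μ i j)

theorem IsIncreasingAlong.nearlyMonotone {E : N → N → Prop} {μ : Measure (N → ℝ)}
    [IsProbabilityMeasure μ] (h : IsIncreasingAlong E μ) {i j : N} (hij : E i j) :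
    NearlyMonotone (μ.map fun x => x i) (pairLaw μ i j).condKernel := by
  rw [← fst_pairLaw μ i j]
  exact (h hij).nearlyMonotone

variable [DecidableEq N]

/-- The finite sets of nodes obtained from the root by successively adding children. -/
inductive IsRootedSubtree (E : N → N → Prop) (r : N) : Finset N → Prop
  | root : IsRootedSubtree E r {r}
  | add {A : Finset N} {p j : N} : IsRootedSubtree E r A → p ∈ A → j ∉ A → E p j →
      IsRootedSubtree E r (insert j A)

/-- Every child depends on a rooted subtree only through its parent. -/
def IsMarkovAlong (E : N → N → Prop) (r : N) (μ : Measure (N → ℝ)) [IsProbabilityMeasure μ] :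
    Prop :=
  ∀ ⦃A p j⦄, IsRootedSubtree E r A → p ∈ A → j ∉ A → E p j → IsMarkovStep μ A p j

/-- Two Markov laws along the same tree with the same coordinate laws. The edge laws of `ν`
increase in both directions, while those of `μ` need only increase away from the root. -/
structure ComparableAlong (E : N → N → Prop) (r : N) (μ ν : Measure (N → ℝ))
    [IsProbabilityMeasure μ] [IsProbabilityMeasure ν] : Prop where
  markov_left : IsMarkovAlong E r μ
  markov_right : IsMarkovAlong E r ν
  map_eq : ∀ i, (μ.map fun x => x i) = ν.map fun x => x i
  increasing_left : IsIncreasingAlong E μ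
  increasing_right : IsIncreasingAlong E ν
  increasing_right_flip : IsIncreasingAlong (flip E) ν

variable {E : N → N → Prop} {r : N} {μ ν : Measure (N → ℝ)} [IsProbabilityMeasure μ]
  [IsProbabilityMeasure ν] {A : Finset N} {p j : N}

/-- A leaf is attached by a Markov step. Seen from an old node `q`, the leaf depends increasingly on
its parent `p`, which depends increasingly on `q`; seen from the leaf, the parent is increasing in
the leaf and the rest is increasing in the parent. -/
theorem IsMarkovAlong.exists_isMonotoneConditional (hν : IsMarkovAlong E r ν)
    (hinc : IsIncreasingAlong E ν) (hinc' : IsIncreasingAlong (flip E) ν)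
    (hA : IsRootedSubtree E r A) {q : N} (hq : q ∈ A) {ε : ℝ} (hε : 0 < ε) :
    ∃ κ : Kernel ℝ (N → ℝ), IsMarkovKernel κ ∧ IsMonotoneConditional ν A q ε κ := by
  induction hA generalizing q ε with
  | root =>
    rw [Finset.mem_singleton.1 hq, Finset.coe_singleton]
    exact ⟨_, inferInstance, isMonotoneConditional_singleton ν r hε.le⟩
  | @add A p j hA hp hj hpj ih =>
    have hε' : 0 < ε / 3 := by positivity
    have hstep := hν hA hp hj hpj
    rw [Finset.coe_insert, ← mul_div_cancel₀ ε (three_ne_zero)]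
    rcases Finset.mem_insert.1 hq with rfl | hqA
    · obtain ⟨κ, _, hκ⟩ := ih hp hε'
      exact hκ.exists_insert_self hε' hp hstep (hinc'.nearlyMonotone hpj)
    · obtain ⟨κ, _, hκ⟩ := ih hqA hε'
      exact hκ.exists_insert hε' hp (ne_of_mem_of_not_mem hqA hj) hstep (hinc.nearlyMonotone hpj)

theorem IsSupermodularTest.integral_resampleKernel {A : Set N} {g : (N → ℝ) → ℝ}
    (hg : IsSupermodularTest (insert j A) g) (hp : p ∈ A) {K : Kernel ℝ ℝ} [IsMarkovKernel K]
    (hK : MonotoneKernel K) : IsSupermodularTest A fun x => ∫ z, g z ∂resampleKernel K p j x := by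
  obtain ⟨c, hc⟩ := hg.bounded
  exact ⟨measurable_integral_kernel _ hg.measurable,
    ⟨c, fun _ => abs_integral_le_of_forall_abs_le hc⟩,
    hg.supermodular.integral_resampleKernel hK hg.measurable hc,
    dependsOn_integral_resampleKernel K j hp hg.measurable hg.dependsOn⟩

namespace ComparableAlong

/-- Passing from `μ` to `ν` on `insert j A` amounts to passing from `μ` to `ν` on `A`, while `j` is
drawn given `p` as under `μ`, and then exchanging the law of the edge `(p, j)`, while the
coordinates in `A` are drawn given `p` as under `ν`. -/
theorem exists_leaf_reduction (H : ComparableAlong E r μ ν) (hA : IsRootedSubtree E r A)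
    (hp : p ∈ A) (hj : j ∉ A) (hpj : E p j) {g : (N → ℝ) → ℝ}
    (hg : IsSupermodularTest (insert j (A : Set N)) g) {ε : ℝ} (hε : 0 < ε) :
    ∃ (g' : (N → ℝ) → ℝ) (h : ℝ × ℝ → ℝ) (c : ℝ), IsSupermodularTest A g' ∧ Measurable h ∧
      (∀ z, |h z| ≤ c) ∧ IncreasingDifferences h ∧
      |(∫ x, g x ∂ν - ∫ x, g x ∂μ) - ((∫ x, g' x ∂ν - ∫ x, g' x ∂μ) +
        (∫ z, h z ∂pairLaw ν p j - ∫ z, h z ∂pairLaw μ p j))| ≤ ε := by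
  obtain ⟨c, hc⟩ := hg.bounded
  have hgm := hg.measurable
  obtain ⟨δ, hδ, hδε⟩ := exists_pos_mul_lt hε (c * 6)
  obtain ⟨K, _, hK, S, hS, hSδ, hSK⟩ := H.increasing_left.nearlyMonotone hpj δ hδ
  obtain ⟨κ, _, hκ⟩ := H.markov_right.exists_isMonotoneConditional H.increasing_right
    H.increasing_right_flip hA hp hδ
  have hpm := measurable_pi_apply (X := fun _ : N => ℝ) p
  have hswitch (ρ : Measure (N → ℝ)) [IsProbabilityMeasure ρ]
      (hρ : (μ.map fun x => x p) = ρ.map fun x => x p) :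
      CloseOn (insert j (A : Set N)) (2 * δ) (resampleKernel K p j ∘ₘ ρ)
        (resampleKernel (pairLaw μ p j).condKernel p j ∘ₘ ρ) := by
    rw [hρ, map_measureReal_apply hpm hS.compl] at hSδ
    exact closeOn_comp_of_eq_on _ (hpm hS) hSδ fun x hx => by
      rw [resampleKernel_apply, resampleKernel_apply, hSK _ hx]
  have hμ := H.markov_left hA hp hj hpj hgm hc hg.dependsOn
  have hμK := hswitch μ rfl hgm hc hg.dependsOn
  have hνK := (hswitch ν (H.map_eq p)).trans (hκ.closeOn_resampleKernel hp _) hgm hc hg.dependsOn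
  have hν := hκ.closeOn_sliceKernel_pairLaw hp (H.markov_right hA hp hj hpj) hgm hc hg.dependsOn
  rw [← H.map_eq p, compProd_condKernel_pairLaw, integral_measure_comp _ _ hgm hc,
    integral_measure_comp _ _ hgm hc] at hνK
  rw [integral_measure_comp (resampleKernel K p j) _ hgm hc] at hμK
  rw [integral_measure_comp _ _ hgm hc] at hν
  refine ⟨_, _, c, hg.integral_resampleKernel hp hK,
    measurable_integral_kernel (sliceKernel κ j) hgm,
    fun z => abs_integral_le_of_forall_abs_le hc,
    hκ.mono.increasingDifferences_integral_sliceKernel hgm hc hg.supermodular, ?_⟩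
  rw [abs_le] at *
  constructor <;> linarith

theorem integral_eq_of_dependsOn_root (H : ComparableAlong E r μ ν) {g : (N → ℝ) → ℝ}
    (hg : IsSupermodularTest {r} g) : ∫ x, g x ∂μ = ∫ x, g x ∂ν := by
  rw [integral_eq_integral_const hg.measurable hg.dependsOn,
    integral_eq_integral_const hg.measurable hg.dependsOn, H.map_eq]

theorem integral_le (H : ComparableAlong E r μ ν)
    (hle : ∀ i j, E i j → OrthantLE (pairLaw μ i j) (pairLaw ν i j)) (hA : IsRootedSubtree E r A)
    {g : (N → ℝ) → ℝ} (hg : IsSupermodularTest A g) : ∫ x, g x ∂μ ≤ ∫ x, g x ∂ν := by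
  induction hA generalizing g with
  | root => exact (H.integral_eq_of_dependsOn_root (Finset.coe_singleton r ▸ hg)).le
  | add hA hp hj hpj ih =>
    rw [Finset.coe_insert] at hg
    refine le_of_forall_pos_le_add fun ε hε => ?_
    obtain ⟨g', h, c, hg', hh, hc, hinc, hdiff⟩ := H.exists_leaf_reduction hA hp hj hpj hg hε
    have hedge := (hle _ _ hpj).integral_le hh hc hinc
    linarith [ih hg', (abs_le.1 hdiff).1]

theorem integral_ge (H : ComparableAlong E r μ ν)
    (hge : ∀ i j, E i j → OrthantLE (pairLaw ν i j) (pairLaw μ i j)) (hA : IsRootedSubtree E r A)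
    {g : (N → ℝ) → ℝ} (hg : IsSupermodularTest A g) : ∫ x, g x ∂ν ≤ ∫ x, g x ∂μ := by
  induction hA generalizing g with
  | root => exact (H.integral_eq_of_dependsOn_root (Finset.coe_singleton r ▸ hg)).ge
  | add hA hp hj hpj ih =>
    rw [Finset.coe_insert] at hg
    refine le_of_forall_pos_le_add fun ε hε => ?_
    obtain ⟨g', h, c, hg', hh, hc, hinc, hdiff⟩ := H.exists_leaf_reduction hA hp hj hpj hg hε
    have hedge := (hge _ _ hpj).integral_le hh hc hinc
    linarith [ih hg', (abs_le.1 hdiff).2]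

end ComparableAlong

end TreeComparison

/-! ### Rooted subtrees of a directed tree -/

section DirectedTree

variable {N : Type*} {E : N → N → Prop} {r : N}

theorem IsDirectedWalk.singleton (E : N → N → Prop) (i : N) : IsDirectedWalk E i i [i] :=
  ⟨List.isChain_singleton i, rfl, rfl⟩

theorem IsDirectedWalk.concat {i x y : N} {l : List N} (h : IsDirectedWalk E i x l)
    (hxy : E x y) : IsDirectedWalk E i y (l ++ [y]) := by
  obtain ⟨hchain, hhead, hlast⟩ := h
  refine ⟨List.isChain_append.2 ⟨hchain, List.isChain_singleton y, ?_⟩, ?_, by simp⟩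
  · rintro _ hx _ ⟨⟩
    obtain rfl := Option.some.inj (hlast.symm.trans hx)
    exact hxy
  · rw [List.head?_append, hhead, Option.some_or]

theorem IsDirectedTree.parent_unique (hT : IsDirectedTree E r) {x y a : N} (hx : E x a)
    (hy : E y a) : x = y := by
  obtain ⟨lx, hlx, -⟩ := hT x
  obtain ⟨ly, hly, -⟩ := hT y
  obtain rfl : lx = ly := List.append_cancel_right ((hT a).unique (hlx.concat hx) (hly.concat hy))
  exact Option.some.inj (hlx.2.2.symm.trans hly.2.2)

theorem IsDirectedTree.ne_of_edge (hT : IsDirectedTree E r) {i j : N} (hij : E i j) : i ≠ j := by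
  rintro rfl
  obtain ⟨l, hl, -⟩ := hT i
  exact List.cons_ne_nil _ _ (List.self_eq_append_right.1 ((hT i).unique hl (hl.concat hij)))

theorem IsDirectedTree.not_edge_root (hT : IsDirectedTree E r) (x : N) : ¬ E x r := by
  intro hx
  obtain ⟨l, hl, -⟩ := hT x
  obtain rfl : l = [] := List.append_cancel_right (bs := [r])
    ((hT r).unique (hl.concat hx) (IsDirectedWalk.singleton E r))
  exact Option.some_ne_none r hl.2.1.symm

theorem IsDirectedWalk.reflTransGen {i j : N} {l : List N} (h : IsDirectedWalk E i j l) :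
    Relation.ReflTransGen E i j := by
  obtain ⟨hchain, hhead, hlast⟩ := h
  cases l with
  | nil => exact absurd hhead.symm (Option.some_ne_none i)
  | cons a l =>
    obtain rfl := Option.some.inj hhead
    refine List.relationReflTransGen_of_exists_isChain_cons l hchain ?_
    rwa [List.getLast?_eq_some_getLast (List.cons_ne_nil a l), Option.some.injEq] at hlast

theorem IsDirectedTree.reflTransGen (hT : IsDirectedTree E r) (i : N) :
    Relation.ReflTransGen E r i :=
  (hT i).exists.choose_spec.reflTransGen

variable [DecidableEq N]

namespace IsRootedSubtree

variable {A : Finset N}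

theorem root_mem (hA : IsRootedSubtree E r A) : r ∈ A := by
  induction hA with
  | root => exact Finset.mem_singleton_self r
  | add _ _ _ _ ih => exact Finset.mem_insert_of_mem ih

theorem parent_mem (hT : IsDirectedTree E r) (hA : IsRootedSubtree E r A) {x a : N} (ha : a ∈ A)
    (hxa : E x a) : x ∈ A := by
  induction hA with
  | root =>
    rw [Finset.mem_singleton.1 ha] at hxa
    exact absurd hxa (hT.not_edge_root x)
  | add _ hp _ hpj ih =>
    rcases Finset.mem_insert.1 ha with rfl | ha
    · exact Finset.mem_insert_of_mem (hT.parent_unique hxa hpj ▸ hp)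
    · exact Finset.mem_insert_of_mem (ih ha)

theorem ancestor_mem (hT : IsDirectedTree E r) (hA : IsRootedSubtree E r A) {x a : N} (ha : a ∈ A)
    (h : Relation.ReflTransGen E x a) : x ∈ A := by
  induction h using Relation.ReflTransGen.head_induction_on with
  | refl => exact ha
  | head hxy _ ih => exact hA.parent_mem hT ih hxy

theorem exists_mem (hA : IsRootedSubtree E r A) {i : N} (h : Relation.ReflTransGen E r i) :
    ∃ A', IsRootedSubtree E r A' ∧ A ⊆ A' ∧ i ∈ A' := by
  induction h with
  | refl => exact ⟨A, hA, subset_rfl, hA.root_mem⟩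
  | @tail b c _ hbc ih =>
    obtain ⟨A', hA', hAA', hb⟩ := ih
    by_cases hc : c ∈ A'
    · exact ⟨A', hA', hAA', hc⟩
    · exact ⟨_, hA'.add hb hc hbc, hAA'.trans (Finset.subset_insert _ _),
        Finset.mem_insert_self c A'⟩

/-- A walk into the leaf has to enter its set of descendants, and the only edge between that set and
its complement is the one from the parent. -/
theorem separates (hT : IsDirectedTree E r) (hA : IsRootedSubtree E r A) {p j : N} (hp : p ∈ A)
    (hj : j ∉ A) (hpj : E p j) : Separates E p (A.erase p) {j} := by
  intro a ha b hb w _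
  obtain rfl : b = j := Finset.mem_singleton.1 hb
  obtain ⟨hap, haA⟩ := Finset.mem_erase.1 ha
  refine ⟨?_, hap.symm, ne_of_mem_of_not_mem hp hj⟩
  obtain ⟨d, hd, hd_fst, hd_snd⟩ := w.exists_boundary_dart {x | Relation.ReflTransGen E b x}ᶜ
    (fun h => hj (hA.ancestor_mem hT haA h)) (fun h => h Relation.ReflTransGen.refl)
  replace hd_fst : ¬ Relation.ReflTransGen E b d.fst := hd_fst
  replace hd_snd : Relation.ReflTransGen E b d.snd := not_not.1 hd_snd
  suffices d.fst = p from this ▸ w.dart_fst_mem_support_of_mem_darts hd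
  rcases ((SimpleGraph.fromRel_adj E _ _).1 d.adj).2 with hdown | hup
  · rcases hd_snd.cases_tail with heq | ⟨x, hbx, hx⟩
    · exact hT.parent_unique (heq ▸ hdown) hpj
    · exact absurd (hT.parent_unique hx hdown ▸ hbx) hd_fst
  · exact absurd (hd_snd.tail hup) hd_fst

end IsRootedSubtree

theorem IsDirectedTree.exists_isRootedSubtree (hT : IsDirectedTree E r) (S : Finset N) :
    ∃ A, IsRootedSubtree E r A ∧ S ⊆ A := by
  induction S using Finset.induction_on with
  | empty => exact ⟨_, .root, Finset.empty_subset _⟩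
  | insert i S _ ih =>
    obtain ⟨A, hA, hSA⟩ := ih
    obtain ⟨A', hA', hAA', hi⟩ := hA.exists_mem (hT.reflTransGen i)
    exact ⟨A', hA', Finset.insert_subset hi (hSA.trans hAA')⟩

end DirectedTree

/-! ### Markov steps -/

section ConditionalIndependence

variable {Ω α β γ : Type*} [MeasurableSpace Ω] [MeasurableSpace α] [MeasurableSpace β]
  [StandardBorelSpace β] [Nonempty β] [MeasurableSpace γ] {μ : Measure Ω} [IsProbabilityMeasure μ]
  {f : Ω → β} {k : Ω → α} {g : Ω → γ}

theorem condDistrib_ae_eq_const_of_indepFun (hf : Measurable f) (hk : Measurable k)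
    (h : IndepFun k f μ) : condDistrib f k μ =ᵐ[μ.map k] Kernel.const α (μ.map f) := by
  have := Measure.isProbabilityMeasure_map (μ := μ) hf.aemeasurable
  have := Measure.isProbabilityMeasure_map (μ := μ) hk.aemeasurable
  rw [condDistrib_ae_eq_iff_measure_eq_compProd _ hf.aemeasurable, Measure.compProd_const]
  exact (indepFun_iff_map_prod_eq_prod_map_map hk.aemeasurable hf.aemeasurable).1 h

theorem condIndepFun_of_indepFun_prodMk [StandardBorelSpace Ω] [StandardBorelSpace γ] [Nonempty γ]
    (hf : Measurable f) (hk : Measurable k) (hg : Measurable g)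
    (h : IndepFun (fun ω => (k ω, g ω)) f μ) :
    CondIndepFun (MeasurableSpace.comap k inferInstance) hk.comap_le g f μ := by
  refine (condIndepFun_iff_condDistrib_prod_ae_eq_prodMkRight hf hg hk).2 ?_
  have hk_ind := condDistrib_ae_eq_const_of_indepFun hf hk (h.comp measurable_fst measurable_id)
  have hk_ind' : ∀ᵐ z ∂μ.map fun ω => (k ω, g ω), condDistrib f k μ z.1 = μ.map f := by
    refine ae_of_ae_map (p := fun s => condDistrib f k μ s = μ.map f)
      measurable_fst.aemeasurable ?_
    rwa [Measure.map_map measurable_fst (hk.prodMk hg)]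
  filter_upwards [condDistrib_ae_eq_const_of_indepFun hf (hk.prodMk hg) h, hk_ind'] with z hz hz'
  rw [hz, Kernel.prodMkRight_apply, hz', Kernel.const_apply]

end ConditionalIndependence

theorem condDistrib_eq_condKernel_pairLaw {N : Type*} (μ : Measure (N → ℝ))
    [IsProbabilityMeasure μ] (i j : N) :
    condDistrib (fun x => x j) (fun x => x i) μ = (pairLaw μ i j).condKernel := by
  rw [condDistrib]
  rfl

section MarkovSteps

open Function

variable {N : Type*} [DecidableEq N] (A : Finset N) (p j : N)

/-- The coordinate `p` of a vector together with its other coordinates in `A`, the data on which the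
conditional independence of a Markov tree law is formulated. -/
def splitAt (x : N → ℝ) : ℝ × (A.erase p → ℝ) :=
  (x p, fun a => x a)

/-- A left inverse of `splitAt A p` up to the coordinates outside `A`, which all receive the value
of the coordinate `p`. -/
def unsplitAt (w : ℝ × (A.erase p → ℝ)) (n : N) : ℝ :=
  if h : n ∈ A.erase p then w.2 ⟨n, h⟩ else w.1

theorem measurable_splitAt : Measurable (splitAt A p) :=
  (measurable_pi_apply p).prodMk (measurable_pi_lambda _ fun _ => measurable_pi_apply _)

theorem measurable_unsplitAt : Measurable (unsplitAt A p) := by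
  refine measurable_pi_lambda _ fun n => ?_
  unfold unsplitAt
  split_ifs <;> fun_prop

theorem unsplitAt_splitAt {n : N} (hn : n ∈ A) (x : N → ℝ) :
    unsplitAt A p (splitAt A p x) n = x n := by
  by_cases h : n ∈ A.erase p
  · rw [unsplitAt, dif_pos h, splitAt]
  · obtain rfl : n = p := by_contra fun hnp => h (Finset.mem_erase.2 ⟨hnp, hn⟩)
    rw [unsplitAt, dif_neg h, splitAt]

theorem update_unsplitAt_splitAt {n : N} (hn : n ∈ insert j (A : Set N)) (x : N → ℝ) (y : ℝ) :
    update (unsplitAt A p (splitAt A p x)) j y n = update x j y n := by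
  rcases eq_or_ne n j with rfl | hnj
  · rw [update_self, update_self]
  · rw [update_of_ne hnj, update_of_ne hnj, unsplitAt_splitAt A p (hn.resolve_left hnj)]

variable {A p j} {μ : Measure (N → ℝ)} [IsProbabilityMeasure μ]

theorem isMarkovStep_of_map_eq_compProd
    (h : μ.map (fun x => (splitAt A p x, x j)) =
      μ.map (splitAt A p) ⊗ₘ (pairLaw μ p j).condKernel.prodMkRight _) :
    IsMarkovStep μ A p j := by
  intro g c hg hc hdep
  set K := (pairLaw μ p j).condKernel
  have hsplit := measurable_splitAt A p
  have := Measure.isProbabilityMeasure_map (μ := μ) hsplit.aemeasurable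
  set G : (ℝ × (A.erase p → ℝ)) × ℝ → ℝ := fun z => g (update (unsplitAt A p z.1) j z.2)
  have hG : Measurable G :=
    hg.comp (measurable_update'.comp ((measurable_unsplitAt A p).prodMap measurable_id))
  have hG_split (x : N → ℝ) (y : ℝ) : G (splitAt A p x, y) = g (update x j y) :=
    hdep fun n hn => update_unsplitAt_splitAt A p j hn x y
  suffices ∫ x, g x ∂μ = ∫ x, g x ∂(resampleKernel K p j ∘ₘ μ) by
    rw [this, sub_self, abs_zero, mul_zero]
  calc ∫ x, g x ∂μ = ∫ x, G (splitAt A p x, x j) ∂μ := by simp only [hG_split, update_eq_self]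
    _ = ∫ z, G z ∂μ.map fun x => (splitAt A p x, x j) :=
      (integral_map (hsplit.prodMk (measurable_pi_apply j)).aemeasurable
        hG.aestronglyMeasurable).symm
    _ = ∫ w, ∫ y, G (w, y) ∂K w.1 ∂μ.map (splitAt A p) := by
      rw [h, Measure.integral_compProd (integrable_of_forall_abs_le hG fun _ => hc _)]
      rfl
    _ = ∫ x, ∫ y, G (splitAt A p x, y) ∂K (x p) ∂μ :=
      integral_map hsplit.aemeasurable (hG.stronglyMeasurable.integral_kernel_prod_right'
        (κ := K.prodMkRight _)).aestronglyMeasurable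
    _ = ∫ x, g x ∂(resampleKernel K p j ∘ₘ μ) := by
      simp only [hG_split, integral_measure_comp _ _ hg hc, integral_resampleKernel K p j hg]

theorem isMarkovStep_of_condIndepFun [Countable N]
    (h : CondIndepFun (MeasurableSpace.comap (fun x : N → ℝ => x p) inferInstance)
      (measurable_pi_apply p).comap_le (fun x (a : A.erase p) => x a) (fun x => x j) μ) :
    IsMarkovStep μ A p j := by
  have hj : Measurable fun x : N → ℝ => x j := measurable_pi_apply j
  have hrest : Measurable fun (x : N → ℝ) (a : A.erase p) => x a :=
    measurable_pi_lambda _ fun _ => measurable_pi_apply _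
  have hcond := (condIndepFun_iff_condDistrib_prod_ae_eq_prodMkRight hj hrest
    (measurable_pi_apply p)).1 h
  rw [condDistrib_eq_condKernel_pairLaw] at hcond
  exact isMarkovStep_of_map_eq_compProd
    ((compProd_map_condDistrib hj.aemeasurable).symm.trans (Measure.compProd_congr hcond))

theorem HasMarkovTreeDependence.isMarkovAlong [Countable N] {E : N → N → Prop} {r : N}
    (hT : IsDirectedTree E r) (hμ : HasMarkovTreeDependence E μ) : IsMarkovAlong E r μ := by
  intro A p j hA hp hj hpj
  have hdisj : Disjoint (A.erase p) {j} :=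
    Finset.disjoint_singleton_right.2 fun h => hj (Finset.mem_of_mem_erase h)
  have hci := hμ _ _ p hdisj (hA.separates hT hp hj hpj)
  exact isMarkovStep_of_condIndepFun (hci.comp measurable_id
    (measurable_pi_apply (⟨j, Finset.mem_singleton_self j⟩ : ({j} : Finset N))))

end MarkovSteps

section InfinitePi

variable {N : Type*} (α : N → Measure ℝ) [∀ n, IsProbabilityMeasure (α n)]

theorem map_infinitePi_eval (n : N) : ((Measure.infinitePi α).map fun x => x n) = α n :=
  (measurePreserving_eval_infinitePi α n).map_eq

theorem iIndepFun_infinitePi_eval :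
    iIndepFun (fun n (x : N → ℝ) => x n) (Measure.infinitePi α) :=
  iIndepFun_infinitePi (X := fun _ => id) (fun _ => measurable_id)

theorem pairLaw_infinitePi {i j : N} (hij : i ≠ j) :
    pairLaw (Measure.infinitePi α) i j = (α i).prod (α j) := by
  have h := (indepFun_iff_map_prod_eq_prod_map_map (measurable_pi_apply i).aemeasurable
    (measurable_pi_apply j).aemeasurable).1 ((iIndepFun_infinitePi_eval α).indepFun hij)
  rw [pairLaw, h, map_infinitePi_eval, map_infinitePi_eval]

theorem isMarkovAlong_infinitePi [Countable N] [DecidableEq N] (E : N → N → Prop) (r : N) :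
    IsMarkovAlong E r (Measure.infinitePi α) := by
  intro A p j _ hp hj _
  have hindep := (iIndepFun_infinitePi_eval α).indepFun_finset A {j}
    (Finset.disjoint_singleton_right.2 hj) measurable_pi_apply
  have hsplit : Measurable fun w : A → ℝ =>
      (w ⟨p, hp⟩, fun a : A.erase p => w ⟨a, Finset.mem_of_mem_erase a.2⟩) := by fun_prop
  exact isMarkovStep_of_condIndepFun (condIndepFun_of_indepFun_prodMk (measurable_pi_apply j)
    (measurable_pi_apply p) (measurable_pi_lambda _ fun _ => measurable_pi_apply _)
    (hindep.comp hsplit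
      (measurable_pi_apply (⟨j, Finset.mem_singleton_self j⟩ : ({j} : Finset N)))))

end InfinitePi

/-! ### Reduction of the supermodular order to bounded functions -/

section Truncation

open Filter

/-- Increasing transformations of the real line along which `φ` is bounded, and dominated uniformly
in `n`, and which eventually fix almost every point. Being increasing, they preserve supermodularity
when applied to the coordinates of a vector. -/
structure IsMonotoneTruncation (α : Measure ℝ) (φ : ℝ → ℝ) (π : ℕ → ℝ → ℝ) : Prop where
  mono : ∀ n, Monotone (π n)
  bounded : ∀ n, ∃ M, ∀ t, φ (π n t) ≤ M
  dominated : ∃ G, Integrable G α ∧ ∀ᵐ t ∂α, ∀ n, φ (π n t) ≤ G t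
  eventually_eq : ∀ᵐ t ∂α, ∀ᶠ n in atTop, π n t = t

/-- The sublevel sets of an integrable lower semicontinuous majorant `g` of `φ` are closed. The
retractions onto them do not increase `g`. -/
theorem exists_isMonotoneTruncation {α : Measure ℝ} [IsProbabilityMeasure α] {φ : ℝ → ℝ}
    (hφ₀ : ∀ t, 0 ≤ φ t) (hφ : Integrable φ α) : ∃ π, IsMonotoneTruncation α φ π := by
  obtain ⟨g, hφg, hg, hg_lt, hg_int, -⟩ :=
    exists_lt_lowerSemicontinuous_integral_gt_nnreal (fun t => ⟨φ t, hφ₀ t⟩) hφ one_pos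
  have φ_le {t : ℝ} {b : ENNReal} (hb : b ≠ ⊤) (h : g t ≤ b) : φ t ≤ b.toReal :=
    ENNReal.toReal_mono hb ((hφg t).le.trans h)
  obtain ⟨t₀, ht₀⟩ := hg_lt.exists
  have level_ne_top (n : ℕ) : g t₀ + n ≠ ⊤ :=
    ENNReal.add_ne_top.2 ⟨ht₀.ne, ENNReal.natCast_ne_top n⟩
  choose π hπ_mono hπ_mem hπ_fix using fun n : ℕ =>
    exists_monotone_retraction (hg.isClosed_preimage (g t₀ + n))
      ⟨t₀, mem_preimage.2 (mem_Iic.2 le_self_add)⟩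
  have g_comp_le (n : ℕ) (t : ℝ) : g (π n t) ≤ g t := by
    by_cases ht : g t ≤ g t₀ + n
    · rw [hπ_fix n t ht]
    · exact (hπ_mem n t).trans (not_le.1 ht).le
  refine ⟨π, hπ_mono, fun n => ⟨_, fun t => φ_le (level_ne_top n) (hπ_mem n t)⟩,
    ⟨_, hg_int, ?_⟩, ?_⟩
  · filter_upwards [hg_lt] with t ht n
    exact φ_le ht.ne (g_comp_le n t)
  · filter_upwards [hg_lt] with t ht
    obtain ⟨m, hm⟩ := ENNReal.exists_nat_gt ht.ne
    filter_upwards [eventually_ge_atTop m] with n hmn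
    exact hπ_fix n t (hm.le.trans ((Nat.cast_le.2 hmn).trans le_add_self))

variable {ι : Type*}

theorem Supermodular.comp_monotone {f : (ι → ℝ) → ℝ} (hf : Supermodular f) {π : ι → ℝ → ℝ}
    (hπ : ∀ i, Monotone (π i)) : Supermodular fun x => f fun i => π i (x i) := by
  intro x y
  dsimp only
  have hinf : (fun i => π i (x i)) ⊓ (fun i => π i (y i)) = fun i => π i ((x ⊓ y) i) :=
    funext fun i => ((hπ i).map_inf _ _).symm
  have hsup : (fun i => π i (x i)) ⊔ (fun i => π i (y i)) = fun i => π i ((x ⊔ y) i) :=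
    funext fun i => ((hπ i).map_sup _ _).symm
  rw [← hinf, ← hsup]
  exact hf _ _

variable [Fintype ι] {φ : ι → ℝ → ℝ}

theorem weight_nonneg (hφ₀ : ∀ i t, 0 ≤ φ i t) (x : ι → ℝ) : 0 ≤ weight φ x :=
  add_nonneg zero_le_one (Finset.sum_nonneg fun i _ => hφ₀ i _)

theorem le_weight (hφ₀ : ∀ i t, 0 ≤ φ i t) (x : ι → ℝ) (i : ι) : φ i (x i) ≤ weight φ x :=
  (Finset.single_le_sum (fun i _ => hφ₀ i (x i)) (Finset.mem_univ i)).trans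
    (le_add_of_nonneg_left zero_le_one)

theorem weight_le_weight {ψ : ι → ℝ → ℝ} {x y : ι → ℝ} (h : ∀ i, φ i (x i) ≤ ψ i (y i)) :
    weight φ x ≤ weight ψ y :=
  add_le_add_right (Finset.sum_le_sum fun i _ => h i) 1

variable {ρ ρ' : Measure (ι → ℝ)} {f : (ι → ℝ) → ℝ} {c : ℝ}

theorem integrable_map_of_integrable_weight (hφm : ∀ i, Measurable (φ i)) (hφ₀ : ∀ i t, 0 ≤ φ i t)
    (h : Integrable (weight φ) ρ) (i : ι) : Integrable (φ i) (ρ.map fun x => x i) := by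
  have hi : Measurable fun x : ι → ℝ => x i := measurable_pi_apply i
  rw [integrable_map_measure (hφm i).aestronglyMeasurable hi.aemeasurable]
  refine h.mono' ((hφm i).comp hi).aestronglyMeasurable (Eventually.of_forall fun x => ?_)
  rw [Function.comp_apply, Real.norm_of_nonneg (hφ₀ i _)]
  exact le_weight hφ₀ x i

variable [IsProbabilityMeasure ρ]

theorem integrable_weight {G : ι → ℝ → ℝ} (hG : ∀ i, Integrable (G i) (ρ.map fun x => x i)) :
    Integrable (weight G) ρ :=
  (integrable_const 1).add <| integrable_finsetSum _ fun i _ =>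
    (hG i).comp_measurable (measurable_pi_apply i)

theorem tendsto_integral_comp_truncation {π : ι → ℕ → ℝ → ℝ}
    (hπ : ∀ i, IsMonotoneTruncation (ρ.map fun x => x i) (φ i) (π i)) (hf : Measurable f)
    (hc₀ : 0 ≤ c) (hc : ∀ x, |f x| ≤ c * weight φ x) :
    Tendsto (fun n => ∫ x, f (fun i => π i n (x i)) ∂ρ) atTop (nhds (∫ x, f x ∂ρ)) := by
  have ae_coord {p : ι → ℝ → Prop} (h : ∀ i, ∀ᵐ t ∂ρ.map fun x => x i, p i t) :
      ∀ᵐ x ∂ρ, ∀ i, p i (x i) :=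
    ae_all_iff.2 fun i => ae_of_ae_map (measurable_pi_apply i).aemeasurable (h i)
  choose G hG hπG using fun i => (hπ i).dominated
  refine tendsto_integral_of_dominated_convergence (fun x => c * weight G x) (fun n => ?_)
    ((integrable_weight hG).const_mul c) (fun n => ?_) ?_
  · exact (hf.comp (measurable_pi_lambda _ fun i =>
      ((hπ i).mono n).measurable.comp (measurable_pi_apply i))).aestronglyMeasurable
  · filter_upwards [ae_coord hπG] with x hx
    exact (hc _).trans (mul_le_mul_of_nonneg_left (weight_le_weight fun i => hx i n) hc₀)
  · filter_upwards [ae_coord fun i => (hπ i).eventually_eq] with x hx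
    refine tendsto_nhds_of_eventually_eq ?_
    filter_upwards [eventually_all.2 hx] with n hn
    exact congrArg f (funext hn)

theorem supermodularLE_of_bounded [IsProbabilityMeasure ρ']
    (hmap : ∀ i, (ρ.map fun x => x i) = ρ'.map fun x => x i)
    (h : ∀ f, IsSupermodularTest univ f → ∫ x, f x ∂ρ ≤ ∫ x, f x ∂ρ') : SupermodularLE ρ ρ' := by
  intro φ hφm hφ₀ hρ _ f hf hsm ⟨c, hc⟩
  replace hc (x : ι → ℝ) : |f x| ≤ |c| * weight φ x :=
    (hc x).trans (mul_le_mul_of_nonneg_right (le_abs_self c) (weight_nonneg hφ₀ x))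
  choose π hπ using fun i =>
    have := Measure.isProbabilityMeasure_map (μ := ρ) (measurable_pi_apply i).aemeasurable
    exists_isMonotoneTruncation (hφ₀ i) (integrable_map_of_integrable_weight hφm hφ₀ hρ i)
  refine le_of_tendsto_of_tendsto' (tendsto_integral_comp_truncation hπ hf (abs_nonneg c) hc)
    (tendsto_integral_comp_truncation (fun i => hmap i ▸ hπ i) hf (abs_nonneg c) hc)
    fun n => h _ ⟨?_, ?_, hsm.comp_monotone fun i => (hπ i).mono n, dependsOn_univ _⟩
  · exact hf.comp (measurable_pi_lambda _ fun i =>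
      ((hπ i).mono n).measurable.comp (measurable_pi_apply i))
  · choose M hM using fun i => (hπ i).bounded n
    exact ⟨|c| * weight (fun i _ => M i) 0, fun x => (hc _).trans
      (mul_le_mul_of_nonneg_left (weight_le_weight fun i => hM i (x i)) (abs_nonneg c))⟩

end Truncation

/-! ### Markov tree laws -/

section Realizes

variable {N : Type*} {F : N → ℝ → I} {E : N → N → Prop} {B C : ∀ i j, E i j → Copula}
  {μ ν : Measure (N → ℝ)} {i j : N}

namespace Realizes

theorem map_real_Iic (h : Realizes F E B μ) (n : N) (t : ℝ) :
    (μ.map fun x => x n).real (Iic t) = F n t := by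
  rw [map_measureReal_apply (measurable_pi_apply n) measurableSet_Iic]
  exact h.1 n t

theorem pairLaw_real (h : Realizes F E B μ) (hij : E i j) (s t : ℝ) :
    (pairLaw μ i j).real (Iic s ×ˢ Iic t) = (B i j hij).toFun (F i s) (F j t) := by
  rw [pairLaw, map_measureReal_apply (measurable_pair i j)
    (measurableSet_Iic.prod measurableSet_Iic)]
  exact h.2 i j hij s t

theorem pairLaw_flip_real (h : Realizes F E B μ) (hij : E i j) (s t : ℝ) :
    (pairLaw μ j i).real (Iic s ×ˢ Iic t) = (B i j hij).swap.toFun (F j s) (F i t) := by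
  rw [← map_swap_pairLaw, map_measureReal_apply measurable_swap
    (measurableSet_Iic.prod measurableSet_Iic), preimage_swap_prod, h.pairLaw_real hij]
  rfl

variable [IsProbabilityMeasure μ]

theorem isIncreasingAlong (h : Realizes F E B μ) (hB : ∀ i j (hij : E i j), (B i j hij).IsSI) :
    IsIncreasingAlong E μ := fun i j hij =>
  intervalwiseIncreasing_of_concaveFst (hB i j hij).concaveFst
    (fun s => by rw [fst_pairLaw, h.map_real_Iic]) (h.pairLaw_real hij)

theorem isIncreasingAlong_flip (h : Realizes F E B μ)
    (hB : ∀ i j (hij : E i j), (B i j hij).IsCI) : IsIncreasingAlong (flip E) μ := fun j i hij =>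
  intervalwiseIncreasing_of_concaveFst (hB i j hij).swap_isSI.concaveFst
    (fun s => by rw [fst_pairLaw, h.map_real_Iic]) (h.pairLaw_flip_real hij)

variable [IsProbabilityMeasure ν]

theorem map_eq (hμ : Realizes F E B μ) (hν : Realizes F E C ν) (n : N) :
    (μ.map fun x => x n) = ν.map fun x => x n :=
  Measure.ext_of_Iic _ _ fun t => (measureReal_eq_measureReal_iff).1 <|
    (hμ.map_real_Iic n t).trans (hν.map_real_Iic n t).symm

theorem orthantLE (hμ : Realizes F E B μ) (hν : Realizes F E C ν) (hij : E i j)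
    (h : (B i j hij).LoLE (C i j hij)) : OrthantLE (pairLaw μ i j) (pairLaw ν i j) where
  fst_eq := by rw [fst_pairLaw, fst_pairLaw, hμ.map_eq hν]
  snd_eq := by rw [snd_pairLaw, snd_pairLaw, hμ.map_eq hν]
  le s t := by
    refine (ENNReal.toReal_le_toReal (by finiteness) (by finiteness)).1 ?_
    rw [← measureReal_def, ← measureReal_def, hμ.pairLaw_real hij, hν.pairLaw_real hij]
    exact h _ _

theorem orthantLE_prod (h : Realizes F E B μ) (hij : E i j) (hB : (B i j hij).IsSI) :
    OrthantLE ((μ.map fun x => x i).prod (μ.map fun x => x j)) (pairLaw μ i j) where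
  fst_eq := by rw [fst_pairLaw, Measure.fst_prod]
  snd_eq := by rw [snd_pairLaw, Measure.snd_prod]
  le s t := by
    refine (ENNReal.toReal_le_toReal (by finiteness) (by finiteness)).1 ?_
    rw [← measureReal_def, ← measureReal_def, measureReal_prod_prod, h.map_real_Iic,
      h.map_real_Iic, h.pairLaw_real hij]
    exact hB.mul_le_apply _ _

end Realizes

end Realizes

section MarkovTree

variable {N : Type*} {F : N → ℝ → I} {E : N → N → Prop} {r : N}
  {B C : ∀ i j, E i j → Copula} {μ ν : Measure (N → ℝ)} [IsProbabilityMeasure μ]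
  [IsProbabilityMeasure ν]

theorem processSupermodularLE_of_isRootedSubtree [DecidableEq N] (hT : IsDirectedTree E r)
    (hmap : ∀ n, (μ.map fun x => x n) = ν.map fun x => x n)
    (h : ∀ ⦃A⦄, IsRootedSubtree E r A → ∀ ⦃g⦄, IsSupermodularTest A g →
      ∫ x, g x ∂μ ≤ ∫ x, g x ∂ν) : ProcessSupermodularLE μ ν := by
  intro m k
  have hk : Measurable fun (x : N → ℝ) (i : Fin m) => x (k i) :=
    measurable_pi_lambda _ fun _ => measurable_pi_apply _
  have := Measure.isProbabilityMeasure_map (μ := μ) hk.aemeasurable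
  have := Measure.isProbabilityMeasure_map (μ := ν) hk.aemeasurable
  refine supermodularLE_of_bounded (fun i => ?_) fun f hf => ?_
  · rw [Measure.map_map (measurable_pi_apply i) hk, Measure.map_map (measurable_pi_apply i) hk]
    exact hmap (k i)
  · obtain ⟨A, hA, hkA⟩ := hT.exists_isRootedSubtree (Finset.univ.image k)
    have hk_mem (i : Fin m) : k i ∈ A := hkA (Finset.mem_image_of_mem k (Finset.mem_univ i))
    obtain ⟨c, hc⟩ := hf.bounded
    rw [integral_map hk.aemeasurable hf.measurable.aestronglyMeasurable,
      integral_map hk.aemeasurable hf.measurable.aestronglyMeasurable]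
    exact h hA ⟨hf.measurable.comp hk, ⟨c, fun _ => hc _⟩, fun _ _ => hf.supermodular _ _,
      fun _ _ hxy => congrArg f (funext fun i => hxy _ (hk_mem i))⟩

namespace ComparableAlong

variable [DecidableEq N]

theorem processSupermodularLE (H : ComparableAlong E r μ ν) (hT : IsDirectedTree E r)
    (hle : ∀ i j, E i j → OrthantLE (pairLaw μ i j) (pairLaw ν i j)) :
    ProcessSupermodularLE μ ν :=
  processSupermodularLE_of_isRootedSubtree hT H.map_eq fun _ hA _ hg => H.integral_le hle hA hg

theorem processSupermodularGE (H : ComparableAlong E r μ ν) (hT : IsDirectedTree E r)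
    (hge : ∀ i j, E i j → OrthantLE (pairLaw ν i j) (pairLaw μ i j)) :
    ProcessSupermodularLE ν μ :=
  processSupermodularLE_of_isRootedSubtree hT (fun i => (H.map_eq i).symm)
    fun _ hA _ hg => H.integral_ge hge hA hg

end ComparableAlong

variable [Countable N]

theorem Realizes.comparableAlong [DecidableEq N] (hT : IsDirectedTree E r)
    (hμ : Realizes F E B μ) (hμdep : HasMarkovTreeDependence E μ) (hν : Realizes F E C ν)
    (hνdep : HasMarkovTreeDependence E ν) (hB : ∀ i j (hij : E i j), (B i j hij).IsSI)
    (hC : ∀ i j (hij : E i j), (C i j hij).IsCI) : ComparableAlong E r μ ν where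
  markov_left := hμdep.isMarkovAlong hT
  markov_right := hνdep.isMarkovAlong hT
  map_eq := hμ.map_eq hν
  increasing_left := hμ.isIncreasingAlong hB
  increasing_right := hν.isIncreasingAlong fun i j hij => (hC i j hij).isSI
  increasing_right_flip := hν.isIncreasingAlong_flip hC

/-- Product laws increase in both directions: the comparison has independence on its CI side. -/
theorem Realizes.psmd (hT : IsDirectedTree E r) (hμ : Realizes F E B μ)
    (hμdep : HasMarkovTreeDependence E μ) (hB : ∀ i j (hij : E i j), (B i j hij).IsSI) :
    PSMD μ := by
  classical
  set α : N → Measure ℝ := fun n => μ.map fun x => x n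
  have hprod {i j : N} (hne : i ≠ j) : pairLaw (Measure.infinitePi α) i j = (α i).prod (α j) :=
    pairLaw_infinitePi α hne
  have H : ComparableAlong E r μ (Measure.infinitePi α) :=
    { markov_left := hμdep.isMarkovAlong hT
      markov_right := isMarkovAlong_infinitePi α E r
      map_eq := fun n => (map_infinitePi_eval α n).symm
      increasing_left := hμ.isIncreasingAlong hB
      increasing_right := fun i j hij => hprod (hT.ne_of_edge hij) ▸ .prod (α i) (α j)
      increasing_right_flip := fun i j hji => hprod (hT.ne_of_edge hji).symm ▸ .prod (α i) (α j) }
  exact H.processSupermodularGE hT fun i j hij =>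
    hprod (hT.ne_of_edge hij) ▸ hμ.orthantLE_prod hij (hB i j hij)

end MarkovTree

theorem corollary1p4 {N : Type*} [Countable N] (E : N → N → Prop) (r : N)
    (hT : IsDirectedTree E r) (F : N → ℝ → I) (B C : ∀ i j, E i j → Copula)
    {Ω Ω' : Type*} [MeasurableSpace Ω] [MeasurableSpace Ω'] (P : Measure Ω) (P' : Measure Ω')
    (X : Ω → N → ℝ) (Y : Ω' → N → ℝ)
    (hX : FollowsMarkovTree F E B X P) (hY : FollowsMarkovTree F E C Y P')
    (hB : ∀ i j (h : E i j), (B i j h).IsSI)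
    (hC : ∀ i j (h : E i j), (C i j h).IsCI) :
    ((∀ i j (h : E i j), (B i j h).LoLE (C i j h)) →
      ProcessSupermodularLE (P.map X) (P'.map Y)) ∧
    ((∀ i j (h : E i j), (C i j h).LoLE (B i j h)) →
      ProcessSupermodularLE (P'.map Y) (P.map X)) ∧
    PSMD (P.map X) ∧ PSMD (P'.map Y) := by
  classical
  obtain ⟨μ, _, hμX, hμ, hμdep⟩ := hX
  obtain ⟨ν, _, hνY, hν, hνdep⟩ := hY
  rw [hμX.map_eq, hνY.map_eq]
  have H := hμ.comparableAlong hT hμdep hν hνdep hB hC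
  exact ⟨fun hlo => H.processSupermodularLE hT fun i j hij => hμ.orthantLE hν hij (hlo i j hij),
    fun hlo => H.processSupermodularGE hT fun i j hij => hν.orthantLE hμ hij (hlo i j hij),
    hμ.psmd hT hμdep hB, hν.psmd hT hνdep fun i j hij => (hC i j hij).isSI⟩
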